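/- Let $F$ be Thompson's group: the group of piecewise linear homeomorphisms of $[0,1]$ that are differentiable except at finitely many dyadic rationals and whose slopes are powers of $2$, with product $(f\cdot g)(t)=g(f(t))$. Let $x_0\in F$ map $[0,\tfrac14],[\tfrac14,\tfrac12],[\tfrac12,1]$ linearly onto $[0,\tfrac12],[\tfrac12,\tfrac34],[\tfrac34,1]$, and let $x_{n+1}$ be the identity on $[0,\tfrac12]$ and $x_{n+1}(t)=\tfrac12(1+x_n(2t-1))$ on $[\tfrac12,1]$. Then $x_0,x_1$ generate $F$. Let $\sigma$ be the automorphism $\sigma(f)(t)=1-f(1-t)$ of $F$, and let $\alpha,\beta:F\to F$ be the monomorphisms with $$\alpha(x_0)=x_0x_1x_0^{-3},\quad \alpha(x_1)=x_0x_1^2x_0^{-3},\qquad \beta(x_0)=x_0x_2,\quad \beta(x_1)=x_1x_2,$$ and $\theta=\beta\circ\alpha$. An element of $F$ is represented by a tree diagram $(T_+,T_-)$, a pair of planar binary rooted trees with the same number of leaves: it maps the $i$-th interval of the dyadic subdivision of $[0,1]$ given by the leaves of $T_+$ linearly onto the $i$-th interval of that given by $T_-$. Draw $T_+$ with its leaves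 on the $x$-axis and its root on the line $y=1$, and $T_-$ upside down below it with the same leaves and its root on the line $y=-1$. Let $\mathcal F$ be the $3$-colorable subgroup of $F$, consisting of the elements that have a tree diagram for which the regions of the strip $-1\le y\le 1$ can be colored with three colors so that regions sharing an edge have different colors. Put $$M_0=\langle \mathcal F,x_0^2\rangle,\quad M_1=\langle\mathcal F,x_1^2\rangle,\quad M_2=\langle\mathcal F,\sigma(x_1)^2\rangle .$$ Let $\vec F=\langle x_0x_1,\,x_1x_2,\,x_2x_3\rangle$ be the oriented subgroup, and, with $H=\langle x_0,\,x_1x_2x_1^{-1}\rangle$, let $$K_1=\langle H,\,x_1^2x_2^{-1}\rangle,\quad K_2=\langle H,\,x_1^2x_2x_1^{-3},\,x_1^3x_2x_1^{-4}\rangle,\quad K_3=\langle x_0,\,x_1x_2x_1^{-3},\,x_1x_2x_3x_2^{-3}x_1^{-1}\rangle$$ be Golan's subgroups. **Theorem.** For each $i\in\{0,1,2\}$, the subgroup $\theta^{-1}(M_i)$ of $F$ is different from every parabolic subgroup $\mathrm{Stab}(t)=\{f\in F: f(t)=t\}$ with $t\in(0,1)$, from $\beta^{-1}(\vec F)$,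 and from $K_1$, $K_2$ and $K_3$. -/

import Mathlib

open Set

noncomputable section

/-! ## Thompson's group `F` -/

/-- Dyadic rational numbers. -/
def IsDyadic (t : ℝ) : Prop := ∃ (k : ℤ) (n : ℕ), t = k / 2 ^ n

/-- `f` is piecewise linear, its finitely many possible breakpoints are dyadic rationals, and all
its slopes are powers of `2` (with integer exponents). -/
def IsPLDyadic (f : unitInterval ≃o unitInterval) : Prop :=
  ∃ S : Finset unitInterval, (∀ s ∈ S, IsDyadic s) ∧
    ∀ a b : unitInterval, a < b → (∀ s ∈ S, s ∉ Ioo a b) →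
      ∃ (n : ℤ) (c : ℝ), ∀ t ∈ Icc a b, (f t : ℝ) = 2 ^ n * t + c

theorem IsDyadic.neg {a : ℝ} (ha : IsDyadic a) : IsDyadic (-a) := by
  obtain ⟨k, n, rfl⟩ := ha
  exact ⟨-k, n, by push_cast; ring⟩

theorem IsDyadic.add {a b : ℝ} (ha : IsDyadic a) (hb : IsDyadic b) : IsDyadic (a + b) := by
  obtain ⟨k, n, rfl⟩ := ha
  obtain ⟨l, m, rfl⟩ := hb
  refine ⟨k * 2 ^ m + l * 2 ^ n, n + m, ?_⟩
  push_cast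
  field_simp
  ring

theorem IsDyadic.sub {a b : ℝ} (ha : IsDyadic a) (hb : IsDyadic b) : IsDyadic (a - b) := by
  rw [sub_eq_add_neg]
  exact ha.add hb.neg

theorem isDyadic_intCast (k : ℤ) : IsDyadic k := ⟨k, 0, by simp⟩

theorem IsDyadic.zpow_mul {a : ℝ} (ha : IsDyadic a) (n : ℤ) : IsDyadic (2 ^ n * a) := by
  obtain ⟨k, m, rfl⟩ := ha
  obtain ⟨p, rfl | rfl⟩ := n.eq_nat_or_neg
  · exact ⟨k * 2 ^ p, m, by push_cast; simp; ring⟩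
  · refine ⟨k, m + p, ?_⟩
    rw [pow_add, zpow_neg, zpow_natCast]
    field_simp

theorem isDyadic_zpow_mul_iff {a : ℝ} (n : ℤ) : IsDyadic (2 ^ n * a) ↔ IsDyadic a := by
  refine ⟨fun h => ?_, fun h => h.zpow_mul n⟩
  have := h.zpow_mul (-n)
  rwa [← mul_assoc, ← zpow_add₀ (by norm_num : (2 : ℝ) ≠ 0), neg_add_cancel, zpow_zero,
    one_mul] at this

theorem IsPLDyadic.isDyadic_iff {f : unitInterval ≃o unitInterval} (hf : IsPLDyadic f)
    (t : unitInterval) : IsDyadic (f t) ↔ IsDyadic t := by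
  obtain ⟨S, hS, h⟩ := hf
  suffices H : ∀ (m : ℕ) (t : unitInterval), (S.filter (· < t)).card = m →
      (IsDyadic (f t) ↔ IsDyadic t) from H _ t rfl
  intro m
  induction m using Nat.strong_induction_on with
  | _ m ih =>
  intro t ht
  by_cases hne : (S.filter (· < t)).Nonempty
  · obtain ⟨s, hs, hmax⟩ := (S.filter (· < t)).exists_max_image id hne
    rw [Finset.mem_filter] at hs
    have hlt : (S.filter (· < s)).card < m := by
      rw [← ht]
      apply Finset.card_lt_card
      refine ⟨fun x hx => ?_, fun hsub => ?_⟩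
      · rw [Finset.mem_filter] at hx ⊢
        exact ⟨hx.1, hx.2.trans hs.2⟩
      · have := hsub (Finset.mem_filter.2 hs)
        exact lt_irrefl _ (Finset.mem_filter.1 this).2
    have hds := hS s hs.1
    have hdfs := (ih _ hlt s rfl).2 hds
    obtain ⟨n, c, hn⟩ := h s t hs.2 (fun x hx hxI =>
      absurd (hmax x (Finset.mem_filter.2 ⟨hx, hxI.2⟩)) (not_le.2 hxI.1))
    have e1 := hn s ⟨le_rfl, hs.2.le⟩
    have e2 := hn t ⟨hs.2.le, le_rfl⟩
    have e3 : (f t : ℝ) = f s + 2 ^ n * ((t : ℝ) - s) := by rw [e1, e2]; ring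
    constructor
    · intro hd
      have : IsDyadic (2 ^ n * ((t : ℝ) - s)) := by
        have := hd.sub hdfs
        rwa [e3, add_sub_cancel_left] at this
      have := ((isDyadic_zpow_mul_iff n).1 this).add hds
      simpa using this
    · intro hd
      rw [e3]
      exact hdfs.add ((hd.sub hds).zpow_mul n)
  · rw [Finset.not_nonempty_iff_eq_empty] at hne
    rcases eq_or_lt_of_le (unitInterval.nonneg' : 0 ≤ t) with h0 | h0
    · rw [← h0]
      have : f 0 = 0 := f.map_bot
      rw [this]
    · obtain ⟨n, c, hn⟩ := h 0 t h0 (fun x hx hxI => by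
        have : x ∈ S.filter (· < t) := Finset.mem_filter.2 ⟨hx, hxI.2⟩
        rw [hne] at this
        simp at this)
      have e1 := hn 0 ⟨le_rfl, h0.le⟩
      have e2 := hn t ⟨h0.le, le_rfl⟩
      have h00 : f 0 = 0 := f.map_bot
      rw [h00] at e1
      simp only [Icc.coe_zero, mul_zero, zero_add] at e1
      rw [e2, ← e1, add_zero, isDyadic_zpow_mul_iff]

theorem IsPLDyadic.refl : IsPLDyadic (OrderIso.refl unitInterval) :=
  ⟨∅, by simp, fun a b _ _ => ⟨0, 0, fun t _ => by simp⟩⟩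

theorem IsPLDyadic.symm {f : unitInterval ≃o unitInterval} (hf : IsPLDyadic f) :
    IsPLDyadic f.symm := by
  have hd := hf.isDyadic_iff
  obtain ⟨S, hS, h⟩ := hf
  classical
  refine ⟨S.image f, ?_, ?_⟩
  · intro s hs
    obtain ⟨x, hx, rfl⟩ := Finset.mem_image.1 hs
    exact (hd x).2 (hS x hx)
  · intro a b hab hm
    obtain ⟨n, c, hn⟩ := h (f.symm a) (f.symm b) (f.symm.lt_iff_lt.2 hab) (fun s hs hI =>
      hm (f s) (Finset.mem_image_of_mem f hs) ⟨f.symm_apply_lt.1 hI.1, f.lt_symm_apply.1 hI.2⟩)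
    refine ⟨-n, -(2 ^ (-n) * c), fun t ht => ?_⟩
    have := hn (f.symm t) ⟨f.symm.le_iff_le.2 ht.1, f.symm.le_iff_le.2 ht.2⟩
    rw [f.apply_symm_apply] at this
    rw [this, mul_add, ← mul_assoc, ← zpow_add₀ (by norm_num : (2 : ℝ) ≠ 0)]
    simp

theorem IsPLDyadic.trans {f g : unitInterval ≃o unitInterval} (hf : IsPLDyadic f)
    (hg : IsPLDyadic g) : IsPLDyadic (f.trans g) := by
  have hd := hf.symm.isDyadic_iff
  obtain ⟨S, hS, h⟩ := hf
  obtain ⟨S', hS', h'⟩ := hg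
  classical
  refine ⟨S ∪ S'.image f.symm, ?_, ?_⟩
  · intro s hs
    rcases Finset.mem_union.1 hs with hs | hs
    · exact hS s hs
    · obtain ⟨x, hx, rfl⟩ := Finset.mem_image.1 hs
      exact (hd x).2 (hS' x hx)
  · intro a b hab hm
    obtain ⟨n, c, hn⟩ := h a b hab (fun s hs => hm s (Finset.mem_union_left _ hs))
    obtain ⟨n', c', hn'⟩ := h' (f a) (f b) (f.lt_iff_lt.2 hab) (fun s hs hI =>
      hm (f.symm s) (Finset.mem_union_right _ (Finset.mem_image_of_mem _ hs))
        ⟨f.lt_symm_apply.2 hI.1, f.symm_apply_lt.2 hI.2⟩)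
    refine ⟨n' + n, 2 ^ n' * c + c', fun t ht => ?_⟩
    have e := hn' (f t) ⟨f.le_iff_le.2 ht.1, f.le_iff_le.2 ht.2⟩
    rw [OrderIso.trans_apply, e, hn t ht, zpow_add₀ (by norm_num : (2 : ℝ) ≠ 0)]
    ring

/-- Thompson's group `F`: the piecewise linear homeomorphisms of `[0,1]` with finitely many
breakpoints, all of them dyadic rationals, whose slopes are powers of `2`. Positivity of the slopes
makes all these homeomorphisms increasing, so they are exactly order automorphisms of `[0,1]`. -/
def ThompsonF : Type := {f : unitInterval ≃o unitInterval // IsPLDyadic f}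

namespace ThompsonF

/-- The product is `(f * g)(t) = g (f t)`. -/
instance : Group ThompsonF where
  mul f g := ⟨f.1.trans g.1, f.2.trans g.2⟩
  one := ⟨OrderIso.refl _, IsPLDyadic.refl⟩
  inv f := ⟨f.1.symm, f.2.symm⟩
  mul_assoc _ _ _ := rfl
  one_mul _ := rfl
  mul_one _ := rfl
  inv_mul_cancel f := Subtype.ext (OrderIso.ext (funext fun t => f.1.apply_symm_apply t))

theorem mul_apply (f g : ThompsonF) (t : unitInterval) : (f * g).1 t = g.1 (f.1 t) := rfl

theorem one_apply (t : unitInterval) : (1 : ThompsonF).1 t = t := rfl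

theorem inv_apply_self (f : ThompsonF) (t : unitInterval) : f⁻¹.1 (f.1 t) = t :=
  f.1.symm_apply_apply t

theorem apply_inv_self (f : ThompsonF) (t : unitInterval) : f.1 (f⁻¹.1 t) = t :=
  f.1.apply_symm_apply t

theorem ext' {f g : ThompsonF} (h : ∀ t, (f.1 t : ℝ) = g.1 t) : f = g :=
  Subtype.ext (OrderIso.ext (funext fun t => Subtype.ext (h t)))

/-- The stabilizer `Stab(t)`; for `t` in the open interval `(0,1)` these are the parabolic
subgroups. -/
def stab (t : unitInterval) : Subgroup ThompsonF where
  carrier := {f | f.1 t = t}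
  mul_mem' {f g} hf hg := by
    change g.1 (f.1 t) = t
    rw [show f.1 t = t from hf]
    exact hg
  one_mem' := rfl
  inv_mem' {f} hf := by
    change f.1.symm t = t
    rw [OrderIso.symm_apply_eq]
    exact (show f.1 t = t from hf).symm

/-! ### The generators `x 0, x 1, …` and the reflection `σ` -/

/-- On `[0,1]`: the map that sends `[0,1/4]`, `[1/4,1/2]`, `[1/2,1]` linearly onto
`[0,1/2]`, `[1/2,3/4]`, `[3/4,1]`. -/
def x0Real (r : ℝ) : ℝ := if r ≤ 1 / 4 then 2 * r else if r ≤ 1 / 2 then r + 1 / 4 else (r + 1) / 2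

/-- The inverse of `x0Real`. -/
def x0RealInv (r : ℝ) : ℝ := if r ≤ 1 / 2 then r / 2 else if r ≤ 3 / 4 then r - 1 / 4 else 2 * r - 1

theorem x0Real_x0RealInv (r : ℝ) : x0Real (x0RealInv r) = r := by
  rcases le_or_gt r (1 / 2) with h | h
  · rw [x0RealInv, if_pos h, x0Real, if_pos (by linarith)]
    ring
  rcases le_or_gt r (3 / 4) with h' | h'
  · rw [x0RealInv, if_neg (by linarith), if_pos h', x0Real, if_neg (by linarith),
      if_pos (by linarith)]
    ring
  · rw [x0RealInv, if_neg (by linarith), if_neg (by linarith), x0Real, if_neg (by linarith),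
      if_neg (by linarith)]
    ring

/-- The order automorphism of `[0,1]` given by `x0Real`. -/
def x0Iso : unitInterval ≃o unitInterval :=
  StrictMono.orderIsoOfRightInverse
    (fun t => ⟨x0Real t, by
      obtain ⟨h0, h1⟩ := t.2
      rw [x0Real]
      split_ifs <;> constructor <;> linarith⟩)
    (by
      intro s t hst
      have hst : (s : ℝ) < t := hst
      rw [← Subtype.coe_lt_coe]
      change x0Real s < x0Real t
      rw [x0Real, x0Real]
      split_ifs <;> linarith)
    (fun t => ⟨x0RealInv t, by
      obtain ⟨h0, h1⟩ := t.2
      rw [x0RealInv]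
      split_ifs <;> constructor <;> linarith⟩)
    (fun t => Subtype.ext (x0Real_x0RealInv t))

theorem x0Iso_apply (t : unitInterval) : (x0Iso t : ℝ) =
    if (t : ℝ) ≤ 1 / 4 then 2 * (t : ℝ) else if (t : ℝ) ≤ 1 / 2 then t + 1 / 4
      else (t + 1) / 2 := rfl

theorem isPLDyadic_x0Iso : IsPLDyadic x0Iso := by
  classical
  refine ⟨{⟨1 / 4, by norm_num, by norm_num⟩, ⟨1 / 2, by norm_num, by norm_num⟩}, ?_, ?_⟩
  · intro s hs
    simp only [Finset.mem_insert, Finset.mem_singleton] at hs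
    rcases hs with rfl | rfl
    · exact ⟨1, 2, by norm_num⟩
    · exact ⟨1, 1, by norm_num⟩
  · intro a b hab hm
    have h1 := hm _ (Finset.mem_insert_self _ _)
    have h2 := hm _ (Finset.mem_insert_of_mem (Finset.mem_singleton_self _))
    simp only [mem_Ioo, ← Subtype.coe_lt_coe, not_and, not_lt] at h1 h2
    rw [← Subtype.coe_lt_coe] at hab
    rcases le_or_gt (1 / 2 : ℝ) a with ha | ha
    · refine ⟨-1, 1 / 2, fun t ht => ?_⟩
      have h3 : (a : ℝ) ≤ t := ht.1
      rw [x0Iso_apply, zpow_neg_one]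
      split_ifs <;> linarith
    · have hb := h2 ha
      rcases le_or_gt (1 / 4 : ℝ) a with ha' | ha'
      · refine ⟨0, 1 / 4, fun t ht => ?_⟩
        have h3 : (a : ℝ) ≤ t := ht.1
        have h4 : (t : ℝ) ≤ b := ht.2
        have h5 : (b : ℝ) ≤ 1 / 2 := hb
        rw [x0Iso_apply, zpow_zero]
        split_ifs <;> linarith
      · have hb' := h1 ha'
        refine ⟨1, 0, fun t ht => ?_⟩
        have h4 : (t : ℝ) ≤ b := ht.2
        have h5 : (b : ℝ) ≤ 1 / 4 := hb'
        rw [x0Iso_apply, zpow_one]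
        split_ifs <;> linarith

/-- The map `t ↦ t` on `[0,1/2]` and `t ↦ (1 + f (2t - 1)) / 2` on `[1/2,1]`. -/
def shiftFun (f : unitInterval → unitInterval) (t : unitInterval) : unitInterval :=
  if h : (t : ℝ) ≤ 1 / 2 then t
  else ⟨(1 + f ⟨2 * t - 1, by linarith, by linarith [t.2.2]⟩) / 2,
    by linarith [(f ⟨2 * t - 1, by linarith, by linarith [t.2.2]⟩).2.1],
    by linarith [(f ⟨2 * t - 1, by linarith, by linarith [t.2.2]⟩).2.2]⟩

theorem shiftFun_of_le (f : unitInterval → unitInterval) {t : unitInterval}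
    (h : (t : ℝ) ≤ 1 / 2) : shiftFun f t = t := dif_pos h

theorem shiftFun_of_ge (f : unitInterval → unitInterval) (hf : f 0 = 0) {t : unitInterval}
    (h : 1 / 2 ≤ (t : ℝ)) : (shiftFun f t : ℝ) =
      (1 + f ⟨2 * t - 1, by linarith, by linarith [t.2.2]⟩) / 2 := by
  rcases h.eq_or_lt with h' | h'
  · rw [shiftFun_of_le f h'.symm.le]
    have : (⟨2 * t - 1, by linarith, by linarith [t.2.2]⟩ : unitInterval) = 0 :=
      Subtype.ext (by simp; linarith)
    rw [this, hf]
    simp; linarith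
  · rw [shiftFun, dif_neg (not_le.2 h')]

theorem shiftFun_shiftFun (f g : unitInterval → unitInterval) (hf : f 0 = 0)
    (hfg : ∀ t, f (g t) = t) (t : unitInterval) : shiftFun f (shiftFun g t) = t := by
  by_cases h : (t : ℝ) ≤ 1 / 2
  · rw [shiftFun_of_le g h, shiftFun_of_le f h]
  · have e : (shiftFun g t : ℝ) = (1 + g ⟨2 * t - 1, by linarith, by linarith [t.2.2]⟩) / 2 := by
      rw [shiftFun, dif_neg h]
    have hge : 1 / 2 ≤ (shiftFun g t : ℝ) := by
      rw [e]
      linarith [(g ⟨2 * t - 1, by linarith, by linarith [t.2.2]⟩).2.1]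
    apply Subtype.ext
    rw [shiftFun_of_ge f hf hge]
    have : (⟨2 * (shiftFun g t : ℝ) - 1, by linarith, by linarith [(shiftFun g t).2.2]⟩ :
        unitInterval) = g ⟨2 * t - 1, by linarith, by linarith [t.2.2]⟩ :=
      Subtype.ext (by dsimp only; rw [e]; ring)
    rw [this, hfg]
    dsimp only
    ring

theorem shiftFun_strictMono (f : unitInterval → unitInterval) (hf : StrictMono f) :
    StrictMono (shiftFun f) := by
  intro s t hst
  have hst' : (s : ℝ) < t := hst
  rw [← Subtype.coe_lt_coe]
  by_cases ht : (t : ℝ) ≤ 1 / 2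
  · rw [shiftFun_of_le f ht, shiftFun_of_le f (hst'.le.trans ht)]
    exact hst
  · have e : (shiftFun f t : ℝ) = (1 + f ⟨2 * t - 1, by linarith, by linarith [t.2.2]⟩) / 2 := by
      rw [shiftFun, dif_neg ht]
    rw [e]
    by_cases hs : (s : ℝ) ≤ 1 / 2
    · rw [shiftFun_of_le f hs]
      have : (f ⟨0, by norm_num, by norm_num⟩ : ℝ) <
          f ⟨2 * t - 1, by linarith, by linarith [t.2.2]⟩ :=
        hf (show (0 : ℝ) < 2 * t - 1 by linarith)
      linarith [(f ⟨0, by norm_num, by norm_num⟩).2.1]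
    · rw [shiftFun, dif_neg hs]
      have : (f ⟨2 * s - 1, by linarith, by linarith [s.2.2]⟩ : ℝ) <
          f ⟨2 * t - 1, by linarith, by linarith [t.2.2]⟩ :=
        hf (show 2 * (s : ℝ) - 1 < 2 * t - 1 by linarith)
      dsimp only
      linarith

def shiftIso (f : unitInterval ≃o unitInterval) : unitInterval ≃o unitInterval :=
  StrictMono.orderIsoOfRightInverse (shiftFun f) (shiftFun_strictMono f f.strictMono)
    (shiftFun f.symm) (shiftFun_shiftFun f f.symm f.map_bot f.apply_symm_apply)

theorem isPLDyadic_shiftIso {f : unitInterval ≃o unitInterval} (hf : IsPLDyadic f) :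
    IsPLDyadic (shiftIso f) := by
  classical
  obtain ⟨S, hS, h⟩ := hf
  refine ⟨insert ⟨1 / 2, by norm_num, by norm_num⟩ (S.image fun s : unitInterval =>
    (⟨(1 + s) / 2, by linarith [s.2.1], by linarith [s.2.2]⟩ : unitInterval)), ?_, ?_⟩
  · intro s hs
    rcases Finset.mem_insert.1 hs with rfl | hs
    · exact ⟨1, 1, by norm_num⟩
    · obtain ⟨x, hx, rfl⟩ := Finset.mem_image.1 hs
      have := ((isDyadic_intCast 1).add (hS x hx)).zpow_mul (-1)
      convert this using 1
      rw [zpow_neg_one]; push_cast; ring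
  · intro a b hab hm
    have h1 := hm _ (Finset.mem_insert_self _ _)
    simp only [mem_Ioo, ← Subtype.coe_lt_coe, not_and, not_lt] at h1
    rcases lt_or_ge (a : ℝ) (1 / 2) with ha | ha
    · have hb := h1 ha
      refine ⟨0, 0, fun t ht => ?_⟩
      have h4 : (t : ℝ) ≤ b := ht.2
      have : shiftIso f t = t := shiftFun_of_le f (h4.trans hb)
      rw [this]; simp
    · have hab' : (a : ℝ) < b := hab
      obtain ⟨n, c, hn⟩ := h ⟨2 * a - 1, by linarith, by linarith [a.2.2]⟩
        ⟨2 * b - 1, by linarith, by linarith [b.2.2]⟩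
        (show 2 * (a : ℝ) - 1 < 2 * b - 1 by linarith) (fun s hs hI =>
          hm _ (Finset.mem_insert_of_mem (Finset.mem_image_of_mem _ hs)) (by
            have i1 : 2 * (a : ℝ) - 1 < s := hI.1
            have i2 : (s : ℝ) < 2 * b - 1 := hI.2
            constructor <;> rw [← Subtype.coe_lt_coe] <;> dsimp only <;> linarith))
      refine ⟨n, (1 + c - 2 ^ n) / 2, fun t ht => ?_⟩
      have i1 : (a : ℝ) ≤ t := ht.1
      have i2 : (t : ℝ) ≤ b := ht.2
      have e : (shiftIso f t : ℝ) = _ := shiftFun_of_ge f f.map_bot (ha.trans i1)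
      have e2 := hn ⟨2 * t - 1, by linarith, by linarith [t.2.2]⟩
        ⟨show 2 * (a : ℝ) - 1 ≤ 2 * t - 1 by linarith,
          show 2 * (t : ℝ) - 1 ≤ 2 * b - 1 by linarith⟩
      rw [e, e2]
      dsimp only
      ring

/-- The right shift: `f` is squeezed into `[1/2,1]` and extended by the identity. -/
def shift (f : ThompsonF) : ThompsonF := ⟨shiftIso f.1, isPLDyadic_shiftIso f.2⟩

/-- The standard generators: `x n` is the identity on `[0, 1 - 2^(-n)]`. -/
def x (n : ℕ) : ThompsonF := shift^[n] ⟨x0Iso, isPLDyadic_x0Iso⟩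

/-- The reflection `σ`, given by `σ(f)(t) = 1 - f (1 - t)`. -/
def sigma : ThompsonF →* ThompsonF where
  toFun f :=
    ⟨{ toFun := fun t => unitInterval.symm (f.1 (unitInterval.symm t))
       invFun := fun t => unitInterval.symm (f.1.symm (unitInterval.symm t))
       left_inv := fun t => by simp
       right_inv := fun t => by simp
       map_rel_iff' := by
        intro a b
        simp }, by
      classical
      obtain ⟨S, hS, h⟩ := f.2
      refine ⟨S.image unitInterval.symm, ?_, ?_⟩
      · intro s hs
        obtain ⟨x, hx, rfl⟩ := Finset.mem_image.1 hs
        have := (isDyadic_intCast 1).sub (hS x hx)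
        simpa using this
      · intro a b hab hm
        obtain ⟨n, c, hn⟩ := h (unitInterval.symm b) (unitInterval.symm a)
          (unitInterval.symm_lt_symm.2 hab) (fun s hs hI => by
            refine hm (unitInterval.symm s) (Finset.mem_image_of_mem _ hs) ⟨?_, ?_⟩
            · rw [← unitInterval.symm_lt_symm, unitInterval.symm_symm]; exact hI.2
            · rw [← unitInterval.symm_lt_symm, unitInterval.symm_symm]; exact hI.1)
        refine ⟨n, 1 - 2 ^ n - c, fun t ht => ?_⟩
        have e := hn (unitInterval.symm t)
          ⟨unitInterval.symm_le_symm.2 ht.2, unitInterval.symm_le_symm.2 ht.1⟩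
        change ((unitInterval.symm (f.1 (unitInterval.symm t)) : unitInterval) : ℝ) = _
        rw [unitInterval.coe_symm_eq, e, unitInterval.coe_symm_eq]
        ring⟩
  map_one' := ext' fun t => by
    change ((unitInterval.symm (unitInterval.symm t) : unitInterval) : ℝ) = t
    rw [unitInterval.symm_symm]
  map_mul' f g := ext' fun t => by
    change ((unitInterval.symm (g.1 (f.1 (unitInterval.symm t))) : unitInterval) : ℝ) =
      (unitInterval.symm (g.1 (unitInterval.symm (unitInterval.symm
        (f.1 (unitInterval.symm t))))) : unitInterval)
    rw [unitInterval.symm_symm]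

theorem sigma_apply (f : ThompsonF) (t : unitInterval) :
    ((sigma f).1 t : ℝ) = 1 - f.1 (unitInterval.symm t) := rfl

theorem shift_of_le (f : ThompsonF) {t : unitInterval} (h : (t : ℝ) ≤ 1 / 2) :
    (shift f).1 t = t := shiftFun_of_le f.1 h

theorem shift_of_ge (f : ThompsonF) {t : unitInterval} (h : 1 / 2 ≤ (t : ℝ)) :
    ((shift f).1 t : ℝ) = (1 + f.1 ⟨2 * t - 1, by linarith, by linarith [t.2.2]⟩) / 2 :=
  shiftFun_of_ge f.1 f.1.map_bot h

theorem x_zero_apply (t : unitInterval) : ((x 0).1 t : ℝ) =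
    if (t : ℝ) ≤ 1 / 4 then 2 * (t : ℝ) else if (t : ℝ) ≤ 1 / 2 then t + 1 / 4
      else (t + 1) / 2 := rfl

theorem x_succ (n : ℕ) : x (n + 1) = shift (x n) := Function.iterate_succ_apply' _ _ _

theorem x_one_apply (t : unitInterval) : ((x 1).1 t : ℝ) =
    if (t : ℝ) ≤ 1 / 2 then (t : ℝ) else if (t : ℝ) ≤ 5 / 8 then 2 * t - 1 / 2
      else if (t : ℝ) ≤ 3 / 4 then t + 1 / 8 else (t + 1) / 2 := by
  rw [x_succ 0]
  rcases le_or_gt (t : ℝ) (1 / 2) with h | h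
  · rw [shift_of_le _ h, if_pos h]
  · rw [shift_of_ge _ h.le, x_zero_apply]
    dsimp only
    split_ifs <;> linarith

theorem x_two_apply (t : unitInterval) : ((x 2).1 t : ℝ) =
    if (t : ℝ) ≤ 3 / 4 then (t : ℝ) else if (t : ℝ) ≤ 13 / 16 then 2 * t - 3 / 4
      else if (t : ℝ) ≤ 7 / 8 then t + 1 / 16 else (t + 1) / 2 := by
  rw [x_succ 1]
  rcases le_or_gt (t : ℝ) (1 / 2) with h | h
  · rw [shift_of_le _ h, if_pos (by linarith)]
  · rw [shift_of_ge _ h.le, x_one_apply]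
    dsimp only
    split_ifs <;> linarith

theorem x_one_mul_x_zero : x 1 * x 0 = x 0 * x 2 := ext' fun t => by
  rw [mul_apply, mul_apply]
  have e1 := x_one_apply t
  have e2 := x_zero_apply t
  rw [x_zero_apply, x_two_apply]
  generalize ((x 1).1 t : ℝ) = p at *
  generalize ((x 0).1 t : ℝ) = q at *
  generalize (t : ℝ) = r at *
  rcases le_or_gt r (1 / 2) with h | h
  · rw [if_pos h] at e1
    have hq : q ≤ 3 / 4 := by rw [e2]; split_ifs <;> linarith
    rw [if_pos hq, e1, e2]
  rw [if_neg (by linarith)] at e1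
  rw [if_neg (by linarith), if_neg (by linarith)] at e2
  have hp : 1 / 2 < p := by rw [e1]; split_ifs <;> linarith
  rw [if_neg (by linarith), if_neg (by linarith), e1, e2]
  split_ifs <;> linarith

theorem sigma_x_zero : sigma (x 0) = (x 0)⁻¹ := by
  rw [eq_inv_iff_mul_eq_one]
  refine ext' fun t => ?_
  rw [mul_apply, one_apply]
  have e1 := sigma_apply (x 0) t
  rw [x_zero_apply, unitInterval.coe_symm_eq] at e1
  rw [x_zero_apply]
  generalize ((sigma (x 0)).1 t : ℝ) = p at *
  generalize (t : ℝ) = r at *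
  rcases le_or_gt r (1 / 2) with h | h
  · rw [if_neg (by linarith)] at e1
    have hp : p = r / 2 := by
      rw [e1]; split_ifs <;> linarith
    rw [hp, if_pos (by linarith)]
    ring
  rcases le_or_gt r (3 / 4) with h' | h'
  · have hp : p = r - 1 / 4 := by
      rw [e1]; split_ifs <;> linarith
    rw [hp, if_neg (by linarith), if_pos (by linarith)]
    ring
  · have hp : p = 2 * r - 1 := by
      rw [e1]; split_ifs <;> linarith
    rw [hp, if_neg (by linarith), if_neg (by linarith)]
    ring

theorem sigma_x_one_apply (t : unitInterval) : ((sigma (x 1)).1 t : ℝ) =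
    if (t : ℝ) ≤ 1 / 4 then (t : ℝ) / 2 else if (t : ℝ) ≤ 3 / 8 then t - 1 / 8
      else if (t : ℝ) ≤ 1 / 2 then 2 * t - 1 / 2 else t := by
  rw [sigma_apply, x_one_apply, unitInterval.coe_symm_eq]
  generalize (t : ℝ) = r
  split_ifs <;> linarith

theorem sigma_x_one : sigma (x 1) = x 0 * x 1 * (x 0)⁻¹ ^ 2 := by
  rw [inv_pow, eq_mul_inv_iff_mul_eq, pow_two, ← mul_assoc]
  refine ext' fun t => ?_
  rw [mul_apply, mul_apply, mul_apply]
  have e1 := sigma_x_one_apply t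
  have e2 := x_zero_apply ((sigma (x 1)).1 t)
  have e3 := x_zero_apply t
  have e4 := x_zero_apply ((x 0).1 ((sigma (x 1)).1 t))
  have e5 := x_one_apply ((x 0).1 t)
  rw [e4, e5]
  clear e4 e5
  have h0 := t.2.1
  generalize ((x 0).1 ((sigma (x 1)).1 t) : ℝ) = q at *
  generalize ((sigma (x 1)).1 t : ℝ) = p at *
  generalize ((x 0).1 t : ℝ) = u at *
  generalize (t : ℝ) = r at *
  rcases le_or_gt r (1 / 4) with h | h
  · rw [if_pos h] at e1 e3
    rw [if_pos (by linarith)] at e2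
    subst e2 e3 e1
    split_ifs <;> linarith
  rcases le_or_gt r (3 / 8) with h' | h'
  · rw [if_neg (by linarith), if_pos h'] at e1
    rw [if_pos (by linarith)] at e2
    rw [if_neg (by linarith), if_pos (by linarith)] at e3
    subst e2 e3 e1
    split_ifs <;> linarith
  rcases le_or_gt r (1 / 2) with h'' | h''
  · rw [if_neg (by linarith), if_neg (by linarith), if_pos h''] at e1
    rw [if_neg (by linarith), if_pos (by linarith)] at e2 e3
    subst e2 e3 e1
    split_ifs <;> linarith
  · rw [if_neg (by linarith), if_neg (by linarith), if_neg (by linarith)] at e1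
    rw [if_neg (by linarith), if_neg (by linarith)] at e2 e3
    subst e2 e3 e1
    split_ifs <;> linarith

/-! ### Existence of the endomorphisms `α` and `β` -/

/-- Near `1` the slope of `f` is `2 ^ n`. -/
def EndSlope (f : ThompsonF) (n : ℤ) : Prop :=
  ∃ a : unitInterval, a < 1 ∧ ∀ t, a ≤ t → 1 - (f.1 t : ℝ) = 2 ^ n * (1 - t)

theorem exists_endSlope (f : ThompsonF) : ∃ n, EndSlope f n := by
  classical
  obtain ⟨S, -, h⟩ := f.2
  obtain ⟨a, ha, hmax⟩ := (insert 0 (S.filter (· < 1))).exists_max_image id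
    (Finset.insert_nonempty _ _)
  have ha1 : a < 1 := by
    rcases Finset.mem_insert.1 ha with rfl | ha
    · exact zero_lt_one
    · exact (Finset.mem_filter.1 ha).2
  obtain ⟨n, c, hn⟩ := h a 1 ha1 (fun s hs hI => absurd
    (hmax s (Finset.mem_insert_of_mem (Finset.mem_filter.2 ⟨hs, hI.2⟩))) (not_le.2 hI.1))
  refine ⟨n, a, ha1, fun t ht => ?_⟩
  have e1 := hn 1 ⟨ha1.le, le_rfl⟩
  have e2 := hn t ⟨ht, unitInterval.le_one'⟩
  have h1 : f.1 1 = 1 := f.1.map_top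
  rw [h1, Icc.coe_one] at e1
  rw [e2]
  linarith

theorem EndSlope.unique {f : ThompsonF} {n m : ℤ} (hn : EndSlope f n) (hm : EndSlope f m) :
    n = m := by
  obtain ⟨a, ha, h⟩ := hn
  obtain ⟨b, hb, h'⟩ := hm
  obtain ⟨t, ht, ht1⟩ := exists_between (max_lt ha hb)
  have e := (h t ((le_max_left _ _).trans ht.le)).symm.trans
    (h' t ((le_max_right _ _).trans ht.le))
  have ht1' : (t : ℝ) < 1 := ht1
  have := mul_right_cancel₀ (by linarith : (1 - (t : ℝ)) ≠ 0) e
  exact zpow_right_injective₀ (by norm_num) (by norm_num) this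

theorem EndSlope.mul {f g : ThompsonF} {n m : ℤ} (hn : EndSlope f n) (hm : EndSlope g m) :
    EndSlope (f * g) (n + m) := by
  obtain ⟨a, ha, h⟩ := hn
  obtain ⟨b, hb, h'⟩ := hm
  refine ⟨max a (f.1.symm b), max_lt ha ?_, fun t ht => ?_⟩
  · rw [f.1.symm_apply_lt]
    have h1 : f.1 1 = 1 := f.1.map_top
    rwa [h1]
  · rw [mul_apply, h' _ (f.1.symm_apply_le.1 ((le_max_right _ _).trans ht)),
      h t ((le_max_left _ _).trans ht), zpow_add₀ (by norm_num : (2 : ℝ) ≠ 0)]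
    ring

theorem x_zero_pow_apply (k : ℕ) (t : unitInterval) (ht : 1 / 2 ≤ (t : ℝ)) :
    1 - ((x 0 ^ k).1 t : ℝ) = (1 - t) / 2 ^ k := by
  have H : ∀ k : ℕ, 1 / 2 ≤ ((x 0 ^ k).1 t : ℝ) ∧
      1 - ((x 0 ^ k).1 t : ℝ) = (1 - t) / 2 ^ k := by
    intro k
    induction k with
    | zero => simpa [one_apply] using ht
    | succ k ih =>
      have e : ((x 0 ^ (k + 1)).1 t : ℝ) = ((x 0 ^ k).1 t + 1) / 2 := by
        rw [pow_succ, mul_apply, x_zero_apply]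
        have := ih.1
        split_ifs <;> linarith
      rw [e, pow_succ]
      refine ⟨by linarith [ih.1], ?_⟩
      rw [← div_div, ← ih.2]
      ring
  exact (H k).2

theorem commute_x_two {u : ThompsonF} (hu : ∀ t : unitInterval, 3 / 4 ≤ (t : ℝ) → u.1 t = t) :
    Commute u (x 2) := by
  have hx : ∀ t : unitInterval, (t : ℝ) ≤ 3 / 4 → (x 2).1 t = t := fun t ht =>
    Subtype.ext (by rw [x_two_apply, if_pos ht])
  have hmid : ∀ s : unitInterval, s = ⟨3 / 4, by norm_num, by norm_num⟩ → u.1 s = s :=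
    fun s hs => hu s (by rw [hs])
  refine ext' fun t => ?_
  rw [mul_apply, mul_apply]
  rcases le_total (t : ℝ) (3 / 4) with h | h
  · have h' : (u.1 t : ℝ) ≤ 3 / 4 := by
      have h2 : u.1 t ≤ u.1 ⟨3 / 4, by norm_num, by norm_num⟩ := u.1.monotone h
      rw [hmid _ rfl] at h2
      exact h2
    rw [hx _ h', hx _ h]
  · have h' : 3 / 4 ≤ ((x 2).1 t : ℝ) := by
      rw [x_two_apply]
      split_ifs <;> linarith
    rw [hu _ h', hu _ h]

theorem exists_commute (f : ThompsonF) {n : ℤ} (hn : EndSlope f n) :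
    ∃ K : ℤ, ∀ k ≥ K, Commute (x 0 ^ k * f * x 0 ^ (n - k)) (x 2) := by
  obtain ⟨a, ha, h⟩ := hn
  have ha' : (a : ℝ) < 1 := ha
  obtain ⟨N, hN⟩ := exists_pow_lt_of_lt_one (by linarith : 0 < 1 - (a : ℝ))
    (by norm_num : (1 / 2 : ℝ) < 1)
  refine ⟨max N n, fun k hk => commute_x_two fun t ht => ?_⟩
  obtain ⟨p, rfl⟩ := Int.eq_ofNat_of_zero_le
    ((Int.natCast_nonneg N).trans ((le_max_left _ _).trans hk))
  obtain ⟨q, hq⟩ := Int.eq_ofNat_of_zero_le (sub_nonneg.2 ((le_max_right _ _).trans hk))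
  have hNp : N ≤ p := by exact_mod_cast (le_max_left _ _).trans hk
  have hnq : n - (p : ℤ) = -(q : ℤ) := by omega
  rw [hnq, zpow_neg, zpow_natCast, zpow_natCast, mul_apply, mul_apply]
  have key : f.1 ((x 0 ^ p).1 t) = (x 0 ^ q).1 t := by
    have e1 := x_zero_pow_apply p t (by linarith)
    have e2 := x_zero_pow_apply q t (by linarith)
    have hle : (1 - (t : ℝ)) / 2 ^ p ≤ 1 - a := by
      have h1 : (1 - (t : ℝ)) / 2 ^ p ≤ 1 / 2 ^ p := by
        gcongr
        linarith
      have h2 : (1 / 2 : ℝ) ^ p ≤ (1 / 2) ^ N :=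
        pow_le_pow_of_le_one (by norm_num) (by norm_num) hNp
      rw [one_div_pow] at h2
      linarith
    have e3 := h ((x 0 ^ p).1 t) (show (a : ℝ) ≤ _ by linarith)
    apply Subtype.ext
    have : (2 : ℝ) ^ n * ((1 - t) / 2 ^ p) = (1 - t) / 2 ^ q := by
      have hn' : n = (p : ℤ) - q := by omega
      rw [hn', zpow_sub₀ (by norm_num), zpow_natCast, zpow_natCast]
      field_simp
    rw [e1, this, ← e2] at e3
    linarith
  rw [key, inv_apply_self]

/-- The graph of `β`. -/
def BetaRel (f g : ThompsonF) : Prop :=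
  ∃ n, EndSlope f n ∧ ∃ K : ℤ, ∀ k ≥ K,
    g = (x 0 * x 2) ^ (-k) * (x 0 ^ k * f * x 0 ^ (n - k)) * (x 0 * x 2) ^ (k - n)

theorem betaRel_of_commute {f : ThompsonF} {n K : ℤ} (hn : EndSlope f n)
    (hK : ∀ k ≥ K, Commute (x 0 ^ k * f * x 0 ^ (n - k)) (x 2)) :
    BetaRel f ((x 0 * x 2) ^ (-K) * (x 0 ^ K * f * x 0 ^ (n - K)) * (x 0 * x 2) ^ (K - n)) := by
  refine ⟨n, hn, K, fun k hk => ?_⟩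
  induction k, hk using Int.leInduction with
  | base => rfl
  | succ k hk ih =>
    rw [ih]
    have hc := hK k hk
    have e1 : x 0 ^ (k + 1) * f * x 0 ^ (n - (k + 1)) =
        x 0 * (x 0 ^ k * f * x 0 ^ (n - k)) * (x 0)⁻¹ := by group
    have e2 : (x 0 * x 2) ^ (-(k + 1)) = (x 0 * x 2) ^ (-k) * ((x 2)⁻¹ * (x 0)⁻¹) := by
      rw [neg_add, zpow_add, zpow_neg_one, mul_inv_rev]
    have e3 : (x 0 * x 2) ^ (k + 1 - n) = x 0 * x 2 * (x 0 * x 2) ^ (k - n) := by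
      rw [show k + 1 - n = 1 + (k - n) by ring, zpow_add, zpow_one]
    rw [e1, e2, e3]
    generalize x 0 ^ k * f * x 0 ^ (n - k) = u at hc
    generalize (x 0 * x 2) ^ (-k) = A
    generalize (x 0 * x 2) ^ (k - n) = B
    have : (x 2)⁻¹ * u * x 2 = u := by rw [mul_assoc, hc.eq, inv_mul_cancel_left]
    calc A * u * B = A * ((x 2)⁻¹ * u * x 2) * B := by rw [this]
      _ = _ := by group

theorem exists_betaRel (f : ThompsonF) : ∃ g, BetaRel f g := by
  obtain ⟨n, hn⟩ := exists_endSlope f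
  obtain ⟨K, hK⟩ := exists_commute f hn
  exact ⟨_, betaRel_of_commute hn hK⟩

theorem BetaRel.unique {f g h : ThompsonF} (hg : BetaRel f g) (hh : BetaRel f h) : g = h := by
  obtain ⟨n, hn, K, hK⟩ := hg
  obtain ⟨m, hm, L, hL⟩ := hh
  obtain rfl := hn.unique hm
  exact (hK _ (le_max_left K L)).trans (hL _ (le_max_right K L)).symm

theorem BetaRel.mul {f f' g g' : ThompsonF} (h : BetaRel f g) (h' : BetaRel f' g') :
    BetaRel (f * f') (g * g') := by
  obtain ⟨n, hn, K, hK⟩ := h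
  obtain ⟨m, hm, L, hL⟩ := h'
  refine ⟨n + m, hn.mul hm, max K (L + n), fun k hk => ?_⟩
  rw [hK k ((le_max_left _ _).trans hk),
    hL (k - n) (by linarith [(le_max_right K (L + n)).trans hk])]
  generalize x 0 * x 2 = y
  group

/-- There is an endomorphism of `F` with `x 0 ↦ x 0 * x 2` and `x 1 ↦ x 1 * x 2`. -/
theorem exists_beta : ∃ b : ThompsonF →* ThompsonF,
    b (x 0) = x 0 * x 2 ∧ b (x 1) = x 1 * x 2 := by
  choose b hb using exists_betaRel
  have hmul : ∀ f g, b (f * g) = b f * b g := fun f g => (hb _).unique ((hb f).mul (hb g))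
  refine ⟨MonoidHom.mk' b hmul, ?_, ?_⟩
  · change b (x 0) = _
    have hs : EndSlope (x 0) (-1) := by
      refine ⟨⟨1 / 2, by norm_num, by norm_num⟩, ?_, fun t ht => ?_⟩
      · rw [← Subtype.coe_lt_coe]; norm_num
      · have ht' : 1 / 2 ≤ (t : ℝ) := ht
        rw [x_zero_apply, zpow_neg_one]
        split_ifs <;> linarith
    have hc : ∀ k ≥ (0 : ℤ), Commute (x 0 ^ k * x 0 * x 0 ^ (-1 - k)) (x 2) := by
      intro k _
      have : x 0 ^ k * x 0 * x 0 ^ (-1 - k) = 1 := by group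
      rw [this]
      exact Commute.one_left _
    rw [(hb _).unique (betaRel_of_commute hs hc)]
    simp
  · change b (x 1) = _
    have hs : EndSlope (x 1) (-1) := by
      refine ⟨⟨3 / 4, by norm_num, by norm_num⟩, ?_, fun t ht => ?_⟩
      · rw [← Subtype.coe_lt_coe]; norm_num
      · have ht' : 3 / 4 ≤ (t : ℝ) := ht
        rw [x_one_apply, zpow_neg_one]
        split_ifs <;> linarith
    have hfix : ∀ t : unitInterval, 1 / 2 ≤ (t : ℝ) → 3 / 4 ≤ ((x 0).1 t : ℝ) := by
      intro t ht
      rw [x_zero_apply]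
      split_ifs <;> linarith
    have hc : ∀ k ≥ (0 : ℤ), Commute (x 0 ^ k * x 1 * x 0 ^ (-1 - k)) (x 2) := by
      intro k hk
      obtain ⟨p, rfl⟩ := Int.eq_ofNat_of_zero_le hk
      refine commute_x_two fun t ht => ?_
      have e : x 0 ^ (p : ℤ) * x 1 * x 0 ^ (-1 - (p : ℤ)) =
          x 0 ^ p * x 1 * (x 0 ^ (p + 1))⁻¹ := by
        rw [← zpow_natCast, ← zpow_natCast, ← zpow_neg]
        congr 2
        push_cast
        ring
      rw [e, mul_apply, mul_apply]
      have key : (x 1).1 ((x 0 ^ p).1 t) = (x 0 ^ (p + 1)).1 t := by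
        rw [pow_succ, mul_apply]
        have e1 := x_zero_pow_apply p t (by linarith)
        have : (1 - (t : ℝ)) / 2 ^ p ≤ 1 / 4 := by
          have h1 : (1 - (t : ℝ)) / 2 ^ p ≤ 1 - t :=
            div_le_self (by linarith [t.2.2]) (one_le_pow₀ (by norm_num))
          linarith
        apply Subtype.ext
        rw [x_one_apply, x_zero_apply]
        split_ifs <;> linarith
      rw [key, inv_apply_self]
    rw [(hb _).unique (betaRel_of_commute hs hc)]
    simp

/-- The monomorphism `β : F → F` (onto the rectangular subgroup `K_(1,2)`) with
`β (x 0) = x 0 * x 2` and `β (x 1) = x 1 * x 2`; these two values determine it, because `x 0` and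
`x 1` generate `F`. -/
def beta : ThompsonF →* ThompsonF := Classical.choose exists_beta

theorem beta_x_zero : beta (x 0) = x 0 * x 2 := (Classical.choose_spec exists_beta).1

theorem beta_x_one : beta (x 1) = x 1 * x 2 := (Classical.choose_spec exists_beta).2

/-- There is an endomorphism of `F` with `x 0 ↦ x 0 * x 1 * x 0 ^ (-3)` and
`x 1 ↦ x 0 * x 1 ^ 2 * x 0 ^ (-3)`. -/
theorem exists_alpha : ∃ a : ThompsonF →* ThompsonF,
    a (x 0) = x 0 * x 1 * x 0 ^ (-3 : ℤ) ∧ a (x 1) = x 0 * x 1 ^ 2 * x 0 ^ (-3 : ℤ) := by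
  have h2 : x 2 = (x 0)⁻¹ * x 1 * x 0 := by
    rw [mul_assoc, x_one_mul_x_zero, inv_mul_cancel_left]
  refine ⟨sigma.comp beta, ?_, ?_⟩
  · rw [MonoidHom.comp_apply, beta_x_zero, h2]
    simp only [map_mul, map_inv, sigma_x_zero, sigma_x_one]
    group
  · rw [MonoidHom.comp_apply, beta_x_one, h2]
    simp only [map_mul, map_inv, sigma_x_zero, sigma_x_one, pow_two]
    group

/-- The monomorphism `α : F → F` (onto the rectangular subgroup `K_(2,1)`) with
`α (x 0) = x 0 * x 1 * x 0 ^ (-3)` and `α (x 1) = x 0 * x 1 ^ 2 * x 0 ^ (-3)`; these two values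
determine it, because `x 0` and `x 1` generate `F`. -/
def alpha : ThompsonF →* ThompsonF := Classical.choose exists_alpha

theorem alpha_x_zero : alpha (x 0) = x 0 * x 1 * x 0 ^ (-3 : ℤ) :=
  (Classical.choose_spec exists_alpha).1

theorem alpha_x_one : alpha (x 1) = x 0 * x 1 ^ 2 * x 0 ^ (-3 : ℤ) :=
  (Classical.choose_spec exists_alpha).2

/-- The monomorphism `θ = β ∘ α` (onto the rectangular subgroup `K_(2,2)`). -/
def theta : ThompsonF →* ThompsonF := beta.comp alpha

/-! ### Tree diagrams and the `3`-colorable subgroup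

Planar binary rooted trees are the terms of `BinaryTree Unit`, with `nil` as the tree that has one
leaf and no caret. -/

/-- The standard dyadic subdivision of `[a,b]` given by a tree: the intervals of its leaves, from
left to right. -/
def leafIntervals : BinaryTree Unit → ℝ → ℝ → List (ℝ × ℝ)
  | .nil, a, b => [(a, b)]
  | .node _ l r, a, b => leafIntervals l a ((a + b) / 2) ++ leafIntervals r ((a + b) / 2) b

/-- `f` is the element represented by the pair of trees `(T₊, T₋)`: the trees have the same number
of leaves and `f` maps the `i`-th leaf interval of `T₊` linearly onto that of `T₋`. -/
def Represents (Tp Tm : BinaryTree Unit) (f : ThompsonF) : Prop :=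
  List.Forall₂ (fun p q : ℝ × ℝ => ∀ t : unitInterval, (t : ℝ) ∈ Icc p.1 p.2 →
      (f.1 t : ℝ) = q.1 + (q.2 - q.1) / (p.2 - p.1) * (t - p.1))
    (leafIntervals Tp 0 1) (leafIntervals Tm 0 1)

/-- The edges of a tree (the one above the root included) whose leaves are numbered
`i, i + 1, …` from the left. In the plane, the region to the left of leaf `j` is numbered `j`, and
an edge is recorded as the pair of regions to its left and to its right: the edge above a vertex
with the leaves `j, …, k - 1` below it separates the regions `j` and `k`. -/
def edgeRegions : BinaryTree Unit → ℕ → List (ℕ × ℕ)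
  | .nil, i => [(i, i + 1)]
  | .node _ l r, i =>
      (i, i + l.numLeaves + r.numLeaves) :: (edgeRegions l i ++ edgeRegions r (i + l.numLeaves))

/-- The strip of the tree diagram `(T₊, T₋)` is `3`-colorable: the regions `0, …, n` of the strip
(`n` the number of leaves; the regions of `T₊` and of `T₋` with the same number form one region of
the strip) can be colored by `ℤ/3` such that regions that share an edge have different colors. -/
def StripColorable (Tp Tm : BinaryTree Unit) : Prop :=
  ∃ c : ℕ → ZMod 3, ∀ e ∈ edgeRegions Tp 0 ++ edgeRegions Tm 0, c e.1 ≠ c e.2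

/-- The `3`-colorable subgroup `𝓕`, as a set: the elements of `F` with a `3`-colorable tree diagram.
(Adding a pair of opposite carets to a tree diagram, or removing one, does not change
colorability, so it does not matter which of its tree diagrams represents the element.) -/
def threeColorable : Set ThompsonF :=
  {f | ∃ Tp Tm : BinaryTree Unit, Represents Tp Tm f ∧ StripColorable Tp Tm}

/-! ### The subgroups that are compared -/

/-- `M₀ = ⟨𝓕, x₀²⟩`. -/
def M₀ : Subgroup ThompsonF := Subgroup.closure (threeColorable ∪ {x 0 ^ 2})

/-- `M₁ = ⟨𝓕, x₁²⟩`. -/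
def M₁ : Subgroup ThompsonF := Subgroup.closure (threeColorable ∪ {x 1 ^ 2})

/-- `M₂ = ⟨𝓕, σ(x₁)²⟩`. -/
def M₂ : Subgroup ThompsonF := Subgroup.closure (threeColorable ∪ {sigma (x 1) ^ 2})

/-- The oriented subgroup of `F`. -/
def oriented : Subgroup ThompsonF :=
  Subgroup.closure {x 0 * x 1, x 1 * x 2, x 2 * x 3}

/-- `H = ⟨x₀, x₁x₂x₁⁻¹⟩`. -/
def H : Subgroup ThompsonF := Subgroup.closure {x 0, x 1 * x 2 * (x 1)⁻¹}

/-- `K₁ = ⟨H, x₁²x₂⁻¹⟩`. -/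
def K₁ : Subgroup ThompsonF := Subgroup.closure ((H : Set ThompsonF) ∪ {x 1 ^ 2 * (x 2)⁻¹})

/-- `K₂ = ⟨H, x₁²x₂x₁⁻³, x₁³x₂x₁⁻⁴⟩`. -/
def K₂ : Subgroup ThompsonF :=
  Subgroup.closure ((H : Set ThompsonF) ∪
    {x 1 ^ 2 * x 2 * x 1 ^ (-3 : ℤ), x 1 ^ 3 * x 2 * x 1 ^ (-4 : ℤ)})

/-- `K₃ = ⟨x₀, x₁x₂x₁⁻³, x₁x₂x₃x₂⁻³x₁⁻¹⟩`. -/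
def K₃ : Subgroup ThompsonF :=
  Subgroup.closure {x 0, x 1 * x 2 * x 1 ^ (-3 : ℤ),
    x 1 * x 2 * x 3 * x 2 ^ (-3 : ℤ) * (x 1)⁻¹}

end ThompsonF

end

/-! Color the strip of a tree diagram with `ℤ/3` and fix one color `k`. Whether `k` lies to the
left, to the right, or on neither side of the edge above a vertex determines the same datum for both
children, because the region inside a caret must take the color that the two outer regions leave
over. This makes a three-state automaton that reads addresses of standard dyadic intervals; each
letter acts by a transposition of the states.

For a start state `s`, the elements of `F` that match addresses of equal state form a subgroup
`preserving s`. In a colored diagram the state of a leaf depends only on the colors of the regions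
beside it, which the two trees share, so `𝓕` lies in `preserving s` for every `s`
(`threeColorable_subset_preserving`). The extra generators of `M₀`, `M₁`, `M₂` respect one color
each, so `M₀`, `M₁`, `M₂` lie in `preserving 0`, `preserving 2`, `preserving 1`. These upper bounds
are all that is needed to show that elements lie outside `M`.

The subgroups `K₁`, `K₂`, `K₃` contain `x 0`, but `θ(x 0)` changes states for every `s`. The word
`betaPreimageWord` is sent by `β` to the generator `x 0 * x 1` of the oriented subgroup, and its
image under `θ` also changes states for every `s`. For `Stab(t)` the separation runs the other way:
`leftMovingWord` and `rightMovingWord` have `θ`-images in `𝓕`, hence in every `M`, while one of them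
moves `t`. Membership and non-membership are decided by finite computations with addresses. -/

namespace ThompsonF

/-! ### Cylinders: the standard dyadic intervals -/

/-- The two halves of `[0,1]`, parametrized linearly. -/
noncomputable def half : Bool → unitInterval → unitInterval
  | false, t => ⟨(t : ℝ) / 2, by linarith [t.2.1], by linarith [t.2.2]⟩
  | true, t => ⟨(1 + (t : ℝ)) / 2, by linarith [t.2.1], by linarith [t.2.2]⟩

/-- The linear parametrization of the standard dyadic interval with address `u`. -/
noncomputable def cyl : List Bool → unitInterval → unitInterval
  | [], s => s
  | b :: u, s => half b (cyl u s)

theorem half_false_coe (t : unitInterval) : (half false t : ℝ) = t / 2 := rfl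

theorem half_true_coe (t : unitInterval) : (half true t : ℝ) = (1 + t) / 2 := rfl

theorem half_injective (b : Bool) : Function.Injective (half b) := by
  intro s t h
  have h' : (half b s : ℝ) = half b t := by rw [h]
  apply Subtype.ext
  cases b
  · rw [half_false_coe, half_false_coe] at h'; linarith
  · rw [half_true_coe, half_true_coe] at h'; linarith

theorem cyl_injective (u : List Bool) : Function.Injective (cyl u) := by
  induction u with
  | nil => exact Function.injective_id
  | cons b u ih => exact (half_injective b).comp ih

theorem cyl_append (u w : List Bool) (s : unitInterval) : cyl (u ++ w) s = cyl u (cyl w s) := by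
  induction u with
  | nil => rfl
  | cons b u ih => exact congrArg (half b) ih

theorem cyl_zero_ne_one (u : List Bool) : (cyl u 0 : ℝ) ≠ cyl u 1 := fun h =>
  zero_ne_one (cyl_injective u (Subtype.ext h))

/-- Needed so that the target address in `Carries` is unique, which lets states of targets be
compared. -/
theorem word_eq_of_cyl_eq {u v : List Bool} (h : ∀ s, cyl u s = cyl v s) : u = v := by
  have aux : ∀ (b : Bool) (u : List Bool), ¬ ∀ s, cyl (b :: u) s = s := by
    intro b u h
    have h0 : (half b (cyl u 0) : ℝ) = 0 := congrArg Subtype.val (h 0)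
    have h1 : (half b (cyl u 1) : ℝ) = 1 := congrArg Subtype.val (h 1)
    cases b
    · rw [half_false_coe] at h1; linarith [(cyl u 1).2.2]
    · rw [half_true_coe] at h0; linarith [(cyl u 0).2.1]
  -- The two halves of `[0,1]` share only the point `1/2`, whereas a parametrized interval is not
  -- constant.
  have aux' : ∀ u v : List Bool, ¬ ∀ s, cyl (false :: u) s = cyl (true :: v) s := by
    intro u v h
    have key : ∀ s, (cyl u s : ℝ) = 1 := by
      intro s
      have h' : (half false (cyl u s) : ℝ) = half true (cyl v s) := congrArg Subtype.val (h s)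
      rw [half_false_coe, half_true_coe] at h'
      linarith [(cyl u s).2.2, (cyl v s).2.1]
    exact cyl_zero_ne_one u ((key 0).trans (key 1).symm)
  induction u generalizing v with
  | nil =>
    cases v with
    | nil => rfl
    | cons b v => exact absurd (fun s => (h s).symm) (aux b v)
  | cons b u ih =>
    cases v with
    | nil => exact absurd h (aux b u)
    | cons c v =>
      cases b <;> cases c
      · rw [ih fun s => half_injective false (h s)]
      · exact absurd h (aux' u v)
      · exact absurd (fun s => (h s).symm) (aux' v u)
      · rw [ih fun s => half_injective true (h s)]

theorem cyl_coe (u : List Bool) (s : unitInterval) :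
    (cyl u s : ℝ) = cyl u 0 + (cyl u 1 - cyl u 0) * s := by
  induction u with
  | nil => simp [cyl]
  | cons b u ih =>
    cases b
    · simp only [cyl, half_false_coe]; rw [ih]; ring
    · simp only [cyl, half_true_coe]; rw [ih]; ring

theorem cyl_zero_lt_one (u : List Bool) : (cyl u 0 : ℝ) < cyl u 1 := by
  induction u with
  | nil => simp [cyl]
  | cons b u ih =>
    cases b
    · simp only [cyl, half_false_coe]; linarith
    · simp only [cyl, half_true_coe]; linarith

/-- `f` maps the standard dyadic interval with address `u` linearly onto the one with
address `v`. -/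
def Carries (f : ThompsonF) (u v : List Bool) : Prop := ∀ s, f.1 (cyl u s) = cyl v s

theorem Carries.mul {f g : ThompsonF} {u v w : List Bool} (hf : Carries f u v)
    (hg : Carries g v w) : Carries (f * g) u w := fun s => by
  rw [mul_apply, hf s, hg s]

theorem Carries.inv {f : ThompsonF} {u v : List Bool} (hf : Carries f u v) :
    Carries f⁻¹ v u := fun s => by
  rw [← hf s, inv_apply_self]

theorem Carries.append {f : ThompsonF} {u v : List Bool} (hf : Carries f u v) (w : List Bool) :
    Carries f (u ++ w) (v ++ w) := fun s => by
  rw [cyl_append, cyl_append, hf]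

theorem Carries.unique {f : ThompsonF} {u v v' : List Bool} (h : Carries f u v)
    (h' : Carries f u v') : v = v' :=
  word_eq_of_cyl_eq fun s => (h s).symm.trans (h' s)

/-! ### Trees and their leaves -/

/-- The addresses of the leaves of a tree, from left to right. -/
def leafWords : BinaryTree Unit → List (List Bool)
  | .nil => [[]]
  | .node _ l r => (leafWords l).map (false :: ·) ++ (leafWords r).map (true :: ·)

theorem leafIntervals_eq_map (T : BinaryTree Unit) (a b : ℝ) : leafIntervals T a b =
    (leafWords T).map fun u => (a + (b - a) * cyl u 0, a + (b - a) * cyl u 1) := by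
  induction T generalizing a b with
  | nil => simp [leafIntervals, leafWords, cyl]
  | node _ l r ihl ihr =>
    simp only [leafIntervals, leafWords, ihl, ihr, List.map_append, List.map_map]
    congr 1 <;> refine List.map_congr_left fun u _ => ?_
    · simp only [Function.comp_apply, cyl, half_false_coe, Prod.mk.injEq]
      constructor <;> ring
    · simp only [Function.comp_apply, cyl, half_true_coe, Prod.mk.injEq]
      constructor <;> ring

theorem carries_iff (f : ThompsonF) (u v : List Bool) : Carries f u v ↔
    ∀ t : unitInterval, (t : ℝ) ∈ Icc (cyl u 0 : ℝ) (cyl u 1) →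
      (f.1 t : ℝ) = cyl v 0 + ((cyl v 1 : ℝ) - cyl v 0) / (cyl u 1 - cyl u 0) * (t - cyl u 0) := by
  have hu := sub_pos.2 (cyl_zero_lt_one u)
  constructor
  · intro h t ht
    obtain ⟨ht0, ht1⟩ := ht
    set s : unitInterval := ⟨(t - cyl u 0) / (cyl u 1 - cyl u 0),
      div_nonneg (by linarith) hu.le, (div_le_one hu).2 (by linarith)⟩ with hs
    have e : t = cyl u s := Subtype.ext (by
      rw [cyl_coe, hs]
      dsimp only
      rw [mul_div_cancel₀ _ hu.ne']
      ring)
    have hts : (t : ℝ) - cyl u 0 = (cyl u 1 - cyl u 0) * s := by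
      rw [hs]
      dsimp only
      rw [mul_div_cancel₀ _ hu.ne']
    rw [hts, ← mul_assoc, div_mul_cancel₀ _ hu.ne', e, h s, cyl_coe v s]
  · intro h s
    have h0 := s.2.1
    have h1 := s.2.2
    have e := h (cyl u s) ⟨by rw [cyl_coe u s]; nlinarith, by rw [cyl_coe u s]; nlinarith⟩
    apply Subtype.ext
    rw [e, cyl_coe v s, cyl_coe u s, add_sub_cancel_left, ← mul_assoc, div_mul_cancel₀ _ hu.ne']

/-- Passing from real endpoints and slopes to addresses is what makes tree diagrams accessible to
computation. -/
theorem represents_iff (Tp Tm : BinaryTree Unit) (f : ThompsonF) : Represents Tp Tm f ↔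
    List.Forall₂ (Carries f) (leafWords Tp) (leafWords Tm) := by
  rw [Represents, leafIntervals_eq_map, leafIntervals_eq_map, List.forall₂_map_left_iff,
    List.forall₂_map_right_iff]
  have e : Carries f = fun u v => _ := funext fun u => funext fun v => propext (carries_iff f u v)
  rw [e]
  simp only [zero_add, sub_zero, one_mul]

/-- Every address is comparable with the address of a leaf. -/
theorem exists_leaf_append_eq (T : BinaryTree Unit) (u : List Bool) :
    ∃ l ∈ leafWords T, ∃ w w', u ++ w = l ++ w' := by
  induction T generalizing u with
  | nil => exact ⟨[], by simp [leafWords], [], u, by simp⟩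
  | node _ l r ihl ihr =>
    rcases u with _ | ⟨b, u⟩
    · obtain ⟨p, hp, w, w', h⟩ := ihl []
      exact ⟨false :: p, by simp [leafWords, hp], false :: w, w', by simpa using h⟩
    · cases b
      · obtain ⟨p, hp, w, w', h⟩ := ihl u
        exact ⟨false :: p, by simp [leafWords, hp], w, w', by simpa using h⟩
      · obtain ⟨p, hp, w, w', h⟩ := ihr u
        exact ⟨true :: p, by simp [leafWords, hp], w, w', by simpa using h⟩

theorem exists_eq_half (t : unitInterval) : ∃ b s, t = half b s := by
  rcases le_total (t : ℝ) (1 / 2) with h | h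
  · refine ⟨false, ⟨2 * t, by linarith [t.2.1], by linarith⟩, Subtype.ext ?_⟩
    rw [half_false_coe]
    dsimp only
    ring
  · refine ⟨true, ⟨2 * t - 1, by linarith, by linarith [t.2.2]⟩, Subtype.ext ?_⟩
    rw [half_true_coe]
    dsimp only
    ring

/-- The leaf intervals of a tree cover `[0,1]`. -/
theorem exists_leaf_eq_cyl (T : BinaryTree Unit) (t : unitInterval) :
    ∃ l ∈ leafWords T, ∃ s, t = cyl l s := by
  induction T generalizing t with
  | nil => exact ⟨[], by simp [leafWords], t, rfl⟩
  | node _ l r ihl ihr =>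
    obtain ⟨b, s, rfl⟩ := exists_eq_half t
    cases b
    · obtain ⟨p, hp, s', rfl⟩ := ihl s
      exact ⟨false :: p, by simp [leafWords, hp], s', rfl⟩
    · obtain ⟨p, hp, s', rfl⟩ := ihr s
      exact ⟨true :: p, by simp [leafWords, hp], s', rfl⟩

theorem eq_of_forall_leaf {f g : ThompsonF} (T : BinaryTree Unit)
    (h : ∀ l ∈ leafWords T, ∃ v, Carries f l v ∧ Carries g l v) : f = g := by
  refine ext' fun t => ?_
  obtain ⟨l, hl, s, rfl⟩ := exists_leaf_eq_cyl T t
  obtain ⟨v, hf, hg⟩ := h l hl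
  rw [hf s, hg s]

/-! ### A three-state automaton and the subgroups that preserve its states

For a proper coloring by `ℤ/3`, each edge separates two regions of different colors. The state of
an edge with respect to a color `k` is `0`, `1`, `2` when `k` is the color of neither side, of the
right-hand side, of the left-hand side, respectively. -/

/-- The state of a child in terms of the state of the parent. -/
def step (s : Fin 3) (b : Bool) : Fin 3 := Equiv.swap 0 (if b then 2 else 1) s

/-- The state of the vertex with address `u`, when the root has the state `s`. -/
def run (s : Fin 3) (u : List Bool) : Fin 3 := u.foldl step s

theorem run_append (s : Fin 3) (u w : List Bool) : run s (u ++ w) = run (run s u) w :=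
  List.foldl_append

/-- Every letter permutes the states. Hence equality of states after a common suffix can be
cancelled back to the vertices themselves. -/
theorem run_injective (w : List Bool) : Function.Injective fun s => run s w := by
  induction w with
  | nil => exact Function.injective_id
  | cons b w ih => exact ih.comp (Equiv.injective _)

/-- Every standard dyadic interval contains one that `f` carries linearly onto a standard dyadic
interval with the same state. -/
def PreservesOnce (s : Fin 3) (f : ThompsonF) : Prop :=
  ∀ u, ∃ w v, Carries f (u ++ w) v ∧ run s (u ++ w) = run s v

/-- The existential form composes without a common refinement of diagrams: refine once for `f`, then
refine the image for `g`. By `PreservesOnce.run_eq` one good refinement already controls every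
interval that is carried linearly. -/
theorem PreservesOnce.mul {s : Fin 3} {f g : ThompsonF} (hf : PreservesOnce s f)
    (hg : PreservesOnce s g) : PreservesOnce s (f * g) := by
  intro u
  obtain ⟨w, v, h, e⟩ := hf u
  obtain ⟨w', v', h', e'⟩ := hg v
  refine ⟨w ++ w', v', ?_, ?_⟩
  · rw [← List.append_assoc]
    exact (h.append w').mul h'
  · rw [← e', ← List.append_assoc, run_append, e, ← run_append]

theorem PreservesOnce.run_eq {s : Fin 3} {f : ThompsonF} (hf : PreservesOnce s f)
    {u v : List Bool} (h : Carries f u v) : run s u = run s v := by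
  obtain ⟨w, v', h', e⟩ := hf u
  -- The target of `u ++ w` can only be `v ++ w`, so `e` compares the states of `u` and `v` after
  -- the same suffix.
  rw [← (h.append w).unique h', run_append, run_append] at e
  exact run_injective w e

/-- Every address extends to one at or below a leaf, and below a leaf both sides run through the
same suffix. -/
theorem preservesOnce_of_leaves {s : Fin 3} {f : ThompsonF} (Tp : BinaryTree Unit)
    (h : ∀ l ∈ leafWords Tp, ∃ v, Carries f l v ∧ run s l = run s v) : PreservesOnce s f := by
  intro u
  obtain ⟨l, hl, w, w', e⟩ := exists_leaf_append_eq Tp u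
  obtain ⟨v, hv, hr⟩ := h l hl
  exact ⟨w, v ++ w', e ▸ hv.append w', by rw [e, run_append, run_append, hr]⟩

/-- The elements of `F` that preserve the states of the automaton started in `s`. -/
def preserving (s : Fin 3) : Subgroup ThompsonF where
  -- The clause on the inverse makes closure under inversion immediate.
  carrier := {f | PreservesOnce s f ∧ PreservesOnce s f⁻¹}
  mul_mem' {f g} hf hg := ⟨hf.1.mul hg.1, by rw [mul_inv_rev]; exact hg.2.mul hf.2⟩
  one_mem' := by
    have : PreservesOnce s 1 := fun u =>
      ⟨[], u, fun _ => by rw [List.append_nil, one_apply], by simp⟩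
    exact ⟨this, by rwa [inv_one]⟩
  inv_mem' {f} hf := ⟨hf.2, by rw [inv_inv]; exact hf.1⟩

theorem mem_preserving_of_forall₂ {s : Fin 3} {f : ThompsonF} (Tp Tm : BinaryTree Unit)
    (hf : List.Forall₂ (Carries f) (leafWords Tp) (leafWords Tm))
    (hs : (leafWords Tp).map (run s) = (leafWords Tm).map (run s)) : f ∈ preserving s := by
  rw [← List.forall₂_eq_eq_eq, List.forall₂_map_left_iff, List.forall₂_map_right_iff] at hs
  rw [List.forall₂_iff_get] at hf hs
  constructor
  · refine preservesOnce_of_leaves Tp fun l hl => ?_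
    obtain ⟨⟨i, hi⟩, rfl⟩ := List.get_of_mem hl
    have hi' : i < (leafWords Tm).length := hf.1.symm ▸ hi
    exact ⟨_, hf.2 i hi hi', hs.2 i hi hi'⟩
  · refine preservesOnce_of_leaves Tm fun l hl => ?_
    obtain ⟨⟨i, hi⟩, rfl⟩ := List.get_of_mem hl
    have hi' : i < (leafWords Tp).length := hf.1 ▸ hi
    exact ⟨_, (hf.2 i hi' hi).inv, (hs.2 i hi' hi).symm⟩

theorem not_mem_preserving {s : Fin 3} {f : ThompsonF} {u v : List Bool} (h : Carries f u v)
    (hr : run s u ≠ run s v) : f ∉ preserving s := fun hf => hr (hf.1.run_eq h)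

/-! ### The `3`-colorable subgroup preserves the states -/

/-- The state of an edge with the colors `a` and `b` on its left and on its right. -/
def edgeState (k a b : ZMod 3) : Fin 3 := if a = k then 2 else if b = k then 1 else 0

/-- The left color, the right color and the remaining color realize the states `2`, `1` and `0`, so
every start state comes from some `k`. -/
theorem exists_edgeState_eq : ∀ (a b : ZMod 3), a ≠ b → ∀ s : Fin 3, ∃ k, edgeState k a b = s := by
  decide

/-- This justifies the choice of transpositions in `step`: `m` is the color inside the caret, hence
the third color. -/
theorem step_edgeState : ∀ k a m b : ZMod 3, a ≠ b → a ≠ m → m ≠ b →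
    step (edgeState k a b) false = edgeState k a m ∧
      step (edgeState k a b) true = edgeState k m b := by
  decide

theorem edgeRegions_head_mem (T : BinaryTree Unit) (i : ℕ) :
    (i, i + T.numLeaves) ∈ edgeRegions T i := by
  cases T <;> simp [edgeRegions, BinaryTree.numLeaves, add_assoc]

/-- The right-hand side involves the tree only through its number of leaves. Two trees with a common
coloring therefore have the same list of leaf states. -/
theorem map_run_leafWords (T : BinaryTree Unit) (c : ℕ → ZMod 3) (k : ZMod 3) (i : ℕ)
    (h : ∀ e ∈ edgeRegions T i, c e.1 ≠ c e.2) :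
    (leafWords T).map (run (edgeState k (c i) (c (i + T.numLeaves)))) =
      (List.range' i T.numLeaves).map fun j => edgeState k (c j) (c (j + 1)) := by
  induction T generalizing i with
  | nil => simp [leafWords, BinaryTree.numLeaves, run]
  | node _ l r ihl ihr =>
    simp only [edgeRegions, List.mem_cons, List.mem_append] at h
    have hl := ihl i fun e he => h e (Or.inr (Or.inl he))
    have hr := ihr (i + l.numLeaves) fun e he => h e (Or.inr (Or.inr he))
    -- The three edges at the top caret make the colors of its three surrounding regions pairwise
    -- distinct.
    have h1 := h _ (Or.inr (Or.inl (edgeRegions_head_mem l i)))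
    have h2 := h _ (Or.inr (Or.inr (edgeRegions_head_mem r _)))
    have h3 := h _ (Or.inl rfl)
    obtain ⟨e1, e2⟩ := step_edgeState k _ _ _ h3 h1 h2
    have e : i + (BinaryTree.node () l r).numLeaves = i + l.numLeaves + r.numLeaves := by
      simp [BinaryTree.numLeaves, add_assoc]
    have e' : (BinaryTree.node () l r).numLeaves = l.numLeaves + r.numLeaves := rfl
    rw [e, e', ← List.range'_append_1, List.map_append, ← hl, ← hr, leafWords, List.map_append,
      List.map_map, List.map_map, ← e1, ← e2]
    rfl

theorem length_leafWords (T : BinaryTree Unit) : (leafWords T).length = T.numLeaves := by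
  induction T with
  | nil => rfl
  | node _ l r ihl ihr => simp [leafWords, BinaryTree.numLeaves, ihl, ihr]

theorem threeColorable_subset_preserving (s : Fin 3) :
    threeColorable ⊆ (preserving s : Set ThompsonF) := by
  rintro f ⟨Tp, Tm, hf, c, hc⟩
  rw [represents_iff] at hf
  have hn : Tp.numLeaves = Tm.numLeaves := by
    rw [← length_leafWords, ← length_leafWords, hf.length_eq]
  have hp : ∀ e ∈ edgeRegions Tp 0, c e.1 ≠ c e.2 := fun e he =>
    hc e (List.mem_append_left _ he)
  have hm : ∀ e ∈ edgeRegions Tm 0, c e.1 ≠ c e.2 := fun e he =>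
    hc e (List.mem_append_right _ he)
  -- Both root edges separate region `0` from region `n`, so one `k` gives both trees the start
  -- state `s`.
  obtain ⟨k, rfl⟩ := exists_edgeState_eq _ _ (hp _ (edgeRegions_head_mem Tp 0)) s
  refine mem_preserving_of_forall₂ Tp Tm hf ?_
  dsimp only
  rw [map_run_leafWords Tp c k 0 hp, hn, map_run_leafWords Tm c k 0 hm]

/-! ### Words in the generators and their action on addresses -/

/-- The action of `x n` on addresses, where it is defined. -/
def genAct : ℕ → List Bool → Option (List Bool)
  | 0, false :: false :: w => some (false :: w)
  | 0, false :: true :: w => some (true :: false :: w)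
  | 0, true :: w => some (true :: true :: w)
  | _ + 1, false :: w => some (false :: w)
  | n + 1, true :: w => (genAct n w).map (true :: ·)
  | _, _ => none

/-- The action of the inverse of `x n` on addresses, where it is defined. -/
def genInvAct : ℕ → List Bool → Option (List Bool)
  | 0, false :: w => some (false :: false :: w)
  | 0, true :: false :: w => some (false :: true :: w)
  | 0, true :: true :: w => some (true :: w)
  | _ + 1, false :: w => some (false :: w)
  | n + 1, true :: w => (genInvAct n w).map (true :: ·)
  | _, _ => none

theorem carries_x_zero (w : List Bool) : Carries (x 0) (false :: false :: w) (false :: w) ∧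
    Carries (x 0) (false :: true :: w) (true :: false :: w) ∧
      Carries (x 0) (true :: w) (true :: true :: w) := by
  refine ⟨fun s => Subtype.ext ?_, fun s => Subtype.ext ?_, fun s => Subtype.ext ?_⟩ <;>
    have h0 := (cyl w s).2.1 <;> have h1 := (cyl w s).2.2 <;> rw [x_zero_apply]
  · change (if (cyl w s : ℝ) / 2 / 2 ≤ 1 / 4 then _ else _) = (cyl w s : ℝ) / 2
    rw [if_pos (by linarith)]
    simp only [cyl, half_false_coe]
    ring
  · have e : (cyl (false :: true :: w) s : ℝ) = (1 + cyl w s) / 2 / 2 := rfl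
    have e' : (cyl (true :: false :: w) s : ℝ) = (1 + cyl w s / 2) / 2 := rfl
    rw [e, e']
    split_ifs <;> linarith
  · have e : (cyl (true :: w) s : ℝ) = (1 + cyl w s) / 2 := rfl
    have e' : (cyl (true :: true :: w) s : ℝ) = (1 + (1 + cyl w s) / 2) / 2 := rfl
    rw [e, e']
    split_ifs <;> linarith

theorem carries_shift_false (f : ThompsonF) (w : List Bool) :
    Carries (shift f) (false :: w) (false :: w) := fun s =>
  shift_of_le f (by simp only [cyl, half_false_coe]; linarith [(cyl w s).2.2])

theorem Carries.shift_true {f : ThompsonF} {u v : List Bool} (h : Carries f u v) :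
    Carries (shift f) (true :: u) (true :: v) := fun s => Subtype.ext <| by
  have e : (cyl (true :: u) s : ℝ) = (1 + cyl u s) / 2 := rfl
  rw [shift_of_ge f (by rw [e]; linarith [(cyl u s).2.1])]
  have e' : (⟨2 * (cyl (true :: u) s : ℝ) - 1, by rw [e]; linarith [(cyl u s).2.1],
      by rw [e]; linarith [(cyl u s).2.2]⟩ : unitInterval) = cyl u s :=
    Subtype.ext (by dsimp only; rw [e]; ring)
  rw [e', h s]
  rfl

theorem carries_of_genAct {n : ℕ} {u v : List Bool} (h : genAct n u = some v) :
    Carries (x n) u v := by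
  induction n generalizing u v with
  | zero =>
    rcases u with _ | ⟨_ | _, _ | ⟨_ | _, w⟩⟩ <;> simp only [genAct, reduceCtorEq,
      Option.some.injEq] at h <;> subst h
    exacts [(carries_x_zero w).1, (carries_x_zero w).2.1, (carries_x_zero _).2.2,
      (carries_x_zero _).2.2, (carries_x_zero _).2.2]
  | succ n ih =>
    rw [x_succ]
    rcases u with _ | ⟨_ | _, w⟩
    · simp [genAct] at h
    · simp only [genAct, Option.some.injEq] at h
      subst h
      exact carries_shift_false _ _
    · simp only [genAct, Option.map_eq_some_iff] at h
      obtain ⟨v, hv, rfl⟩ := h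
      exact (ih hv).shift_true

theorem genAct_of_genInvAct {n : ℕ} {u v : List Bool} (h : genInvAct n u = some v) :
    genAct n v = some u := by
  induction n generalizing u v with
  | zero =>
    rcases u with _ | ⟨_ | _, _ | ⟨_ | _, w⟩⟩ <;> simp only [genInvAct, reduceCtorEq,
      Option.some.injEq] at h <;> subst h <;> simp [genAct]
  | succ n ih =>
    rcases u with _ | ⟨_ | _, w⟩
    · simp [genInvAct] at h
    · simp only [genInvAct, Option.some.injEq] at h
      subst h
      simp [genAct]
    · simp only [genInvAct, Option.map_eq_some_iff] at h
      obtain ⟨v, hv, rfl⟩ := h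
      simp [genAct, ih hv]

/-- The element of `F` given by a word; `(n, true)` stands for `x n` and `(n, false)` for its
inverse. -/
noncomputable def evalWord (W : List (ℕ × Bool)) : ThompsonF :=
  (W.map fun p => if p.2 then x p.1 else (x p.1)⁻¹).prod

/-- The formal inverse of a word. -/
def invWord (W : List (ℕ × Bool)) : List (ℕ × Bool) := (W.map fun p => (p.1, !p.2)).reverse

theorem evalWord_append (V W : List (ℕ × Bool)) :
    evalWord (V ++ W) = evalWord V * evalWord W := by
  simp [evalWord]

theorem evalWord_invWord (W : List (ℕ × Bool)) : evalWord (invWord W) = (evalWord W)⁻¹ := by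
  induction W with
  | nil => simp [evalWord, invWord]
  | cons p W ih =>
    have e : invWord (p :: W) = invWord W ++ [(p.1, !p.2)] := by simp [invWord]
    rw [e, evalWord_append, ih]
    obtain ⟨n, b⟩ := p
    cases b <;> simp [evalWord]

/-- The action of a word on addresses, where it is defined. -/
def wordAct : List (ℕ × Bool) → List Bool → Option (List Bool)
  | [], u => some u
  | (n, true) :: W, u => (genAct n u).bind (wordAct W)
  | (n, false) :: W, u => (genInvAct n u).bind (wordAct W)

theorem carries_of_wordAct {W : List (ℕ × Bool)} {u v : List Bool} (h : wordAct W u = some v) :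
    Carries (evalWord W) u v := by
  induction W generalizing u with
  | nil =>
    obtain rfl : u = v := by simpa [wordAct] using h
    exact fun s => rfl
  | cons p W ih =>
    obtain ⟨n, _ | _⟩ := p <;> simp only [wordAct, Option.bind_eq_some_iff] at h <;>
      obtain ⟨z, hz, h⟩ := h
    · have e : evalWord ((n, false) :: W) = (x n)⁻¹ * evalWord W := by simp [evalWord]
      rw [e]
      exact (carries_of_genAct (genAct_of_genInvAct hz)).inv.mul (ih h)
    · have e : evalWord ((n, true) :: W) = x n * evalWord W := by simp [evalWord]
      rw [e]
      exact (carries_of_genAct hz).mul (ih h)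

theorem forall₂_carries_of_map_wordAct {W : List (ℕ × Bool)} {L L' : List (List Bool)}
    (h : L.map (wordAct W) = L'.map some) : List.Forall₂ (Carries (evalWord W)) L L' := by
  rw [← List.forall₂_eq_eq_eq, List.forall₂_map_left_iff, List.forall₂_map_right_iff] at h
  exact h.imp fun _ _ => carries_of_wordAct

/-- Reduces an identity in `F` to finitely many evaluations of a computable partial action. -/
theorem evalWord_eq_of_wordAct {V W : List (ℕ × Bool)} (T : BinaryTree Unit)
    (h : ∀ l ∈ leafWords T, ∃ v, wordAct V l = some v ∧ wordAct W l = some v) :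
    evalWord V = evalWord W :=
  eq_of_forall_leaf T fun l hl =>
    let ⟨v, hv, hw⟩ := h l hl
    ⟨v, carries_of_wordAct hv, carries_of_wordAct hw⟩

/-! ### The endomorphisms on words -/

/-- Substitution of `V` for `x 0` and of `W` for `x 1` in a word in these two generators. -/
def substWord (V W : List (ℕ × Bool)) : List (ℕ × Bool) → List (ℕ × Bool)
  | [] => []
  | (n, b) :: U =>
      (bif b then (if n = 0 then V else W) else invWord (if n = 0 then V else W)) ++
        substWord V W U

/-- The bound on the indices matters: `substWord` puts `W` for every nonzero index, which is right
only for `x 1`. -/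
theorem map_evalWord (φ : ThompsonF →* ThompsonF) {V W : List (ℕ × Bool)}
    (hV : φ (x 0) = evalWord V) (hW : φ (x 1) = evalWord W) (U : List (ℕ × Bool))
    (hU : ∀ p ∈ U, p.1 < 2) : φ (evalWord U) = evalWord (substWord V W U) := by
  induction U with
  | nil => simp [evalWord, substWord]
  | cons p U ih =>
    obtain ⟨n, b⟩ := p
    have hn : n < 2 := hU (n, b) List.mem_cons_self
    have hφ : φ (x n) = evalWord (if n = 0 then V else W) := by
      interval_cases n
      exacts [hV, hW]
    have e : evalWord ((n, b) :: U) = (if b then x n else (x n)⁻¹) * evalWord U := by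
      simp [evalWord]
    rw [e, map_mul, ih fun q hq => hU q (List.mem_cons_of_mem _ hq), substWord, evalWord_append]
    cases b
    · simp [evalWord_invWord, hφ]
    · simp [hφ]

/-- A word in `x 0`, `x 1`, `x 2` for the image under `β` of a word in `x 0`, `x 1`. -/
def betaWord : List (ℕ × Bool) → List (ℕ × Bool) :=
  substWord [(0, true), (2, true)] [(1, true), (2, true)]

/-- A word in `x 0`, `x 1` for the image under `α` of a word in `x 0`, `x 1`. -/
def alphaWord : List (ℕ × Bool) → List (ℕ × Bool) :=
  substWord [(0, true), (1, true), (0, false), (0, false), (0, false)]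
    [(0, true), (1, true), (1, true), (0, false), (0, false), (0, false)]

theorem beta_evalWord (U : List (ℕ × Bool)) (hU : ∀ p ∈ U, p.1 < 2) :
    beta (evalWord U) = evalWord (betaWord U) := by
  refine map_evalWord beta ?_ ?_ U hU
  · simp [evalWord, beta_x_zero]
  · simp [evalWord, beta_x_one]

theorem alpha_evalWord (U : List (ℕ × Bool)) (hU : ∀ p ∈ U, p.1 < 2) :
    alpha (evalWord U) = evalWord (alphaWord U) := by
  refine map_evalWord alpha ?_ ?_ U hU
  · rw [alpha_x_zero]
    simp only [evalWord, List.map_cons, List.map_nil, List.prod_cons, List.prod_nil, if_true,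
      Bool.false_eq_true, if_false]
    group
  · rw [alpha_x_one, pow_two]
    simp only [evalWord, List.map_cons, List.map_nil, List.prod_cons, List.prod_nil, if_true,
      Bool.false_eq_true, if_false]
    group

theorem theta_evalWord (U : List (ℕ × Bool)) (hU : ∀ p ∈ U, p.1 < 2)
    (hU' : ∀ p ∈ alphaWord U, p.1 < 2) :
    theta (evalWord U) = evalWord (betaWord (alphaWord U)) := by
  rw [theta, MonoidHom.comp_apply, alpha_evalWord U hU, beta_evalWord _ hU']

/-! ### The subgroups `M₀`, `M₁`, `M₂` preserve the states -/

/-- The tree with the left subtree `l` and the right subtree `r`. -/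
abbrev caret (l r : BinaryTree Unit) : BinaryTree Unit := .node () l r

/-- Only the additional generator needs a check. The colorings forced by its two trees differ, but
they agree on where one color occurs: the color of neither outer region for `x 0 ^ 2`, of the
leftmost region for `x 1 ^ 2`, and of the rightmost for `sigma (x 1) ^ 2`. This is why the start
states are `0`, `2` and `1`. -/
theorem closure_threeColorable_le_preserving (s : Fin 3) (W : List (ℕ × Bool))
    (Tp Tm : BinaryTree Unit) (hW : (leafWords Tp).map (wordAct W) = (leafWords Tm).map some)
    (hs : (leafWords Tp).map (run s) = (leafWords Tm).map (run s)) :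
    Subgroup.closure (threeColorable ∪ {evalWord W}) ≤ preserving s := by
  rw [Subgroup.closure_le]
  refine union_subset (threeColorable_subset_preserving s) (singleton_subset_iff.2 ?_)
  exact mem_preserving_of_forall₂ Tp Tm (forall₂_carries_of_map_wordAct hW) hs

theorem M₀_le_preserving : M₀ ≤ preserving 0 := by
  have e : x 0 ^ 2 = evalWord [(0, true), (0, true)] := by simp [evalWord, pow_two]
  rw [M₀, e]
  exact closure_threeColorable_le_preserving _ _
    (caret (caret (caret .nil .nil) .nil) .nil) (caret .nil (caret .nil (caret .nil .nil)))
    (by decide) (by decide)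

theorem M₁_le_preserving : M₁ ≤ preserving 2 := by
  have e : x 1 ^ 2 = evalWord [(1, true), (1, true)] := by simp [evalWord, pow_two]
  rw [M₁, e]
  exact closure_threeColorable_le_preserving _ _
    (caret .nil (caret (caret (caret .nil .nil) .nil) .nil))
    (caret .nil (caret .nil (caret .nil (caret .nil .nil)))) (by decide) (by decide)

theorem M₂_le_preserving : M₂ ≤ preserving 1 := by
  have e : sigma (x 1) ^ 2 = evalWord [(0, true), (1, true), (0, false), (0, false),
      (0, true), (1, true), (0, false), (0, false)] := by
    rw [sigma_x_one]
    simp [evalWord, pow_two, mul_assoc]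
  rw [M₂, e]
  exact closure_threeColorable_le_preserving _ _
    (caret (caret .nil (caret .nil (caret .nil .nil))) .nil)
    (caret (caret (caret (caret .nil .nil) .nil) .nil) .nil) (by decide) (by decide)

/-! ### Elements that tell the subgroups apart -/

theorem theta_evalWord_not_mem_preserving {s : Fin 3} {U : List (ℕ × Bool)} (u v : List Bool)
    (hU : ∀ p ∈ U, p.1 < 2) (hU' : ∀ p ∈ alphaWord U, p.1 < 2)
    (hw : wordAct (betaWord (alphaWord U)) u = some v) (hr : run s u ≠ run s v) :
    theta (evalWord U) ∉ preserving s := by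
  rw [theta_evalWord U hU hU']
  exact not_mem_preserving (carries_of_wordAct hw) hr

theorem theta_x_zero_not_mem_preserving (s : Fin 3) : theta (x 0) ∉ preserving s := by
  have e : x 0 = evalWord [(0, true)] := by simp [evalWord]
  rw [e]
  -- The two addresses act on the states by the distinct transpositions `(0 1)` and `(0 2)`. These
  -- agree on no state, so one pair of addresses serves all `s`.
  exact theta_evalWord_not_mem_preserving [true, true, false] [true, false, false] (by decide)
    (by decide) (by decide) (by revert s; decide)

/-- The word `x₀x₁x₀⁻¹x₁⁻¹x₀`. -/
def betaPreimageWord : List (ℕ × Bool) :=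
  [(0, true), (1, true), (0, false), (1, false), (0, true)]

theorem beta_betaPreimageWord_mem_oriented : beta (evalWord betaPreimageWord) ∈ oriented := by
  have e : evalWord (betaWord betaPreimageWord) = x 0 * x 1 := by
    have e' : x 0 * x 1 = evalWord [(0, true), (1, true)] := by simp [evalWord]
    rw [e']
    -- The tree is fine enough for both words to act letter by letter on each of its leaves.
    refine evalWord_eq_of_wordAct
      (caret (caret .nil (caret .nil (caret .nil .nil))) (caret (caret .nil .nil) .nil)) fun l hl => ?_
    have hl' : l ∈ [[false, false], [false, true, false], [false, true, true, false],
      [false, true, true, true], [true, false, false], [true, false, true], [true, true]] := hl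
    simp only [List.mem_cons, List.not_mem_nil, or_false] at hl'
    rcases hl' with rfl | rfl | rfl | rfl | rfl | rfl | rfl
    · exact ⟨[false], by decide, by decide⟩
    · exact ⟨[true, false], by decide, by decide⟩
    · exact ⟨[true, true, false, false], by decide, by decide⟩
    · exact ⟨[true, true, false, true], by decide, by decide⟩
    · exact ⟨[true, true, true, false, false], by decide, by decide⟩
    · exact ⟨[true, true, true, false, true], by decide, by decide⟩
    · exact ⟨[true, true, true, true], by decide, by decide⟩
  rw [beta_evalWord _ (by decide), e]
  exact Subgroup.subset_closure (by simp)

/-- The same pair of addresses as for `theta (x 0)` witnesses the change of state. -/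
theorem theta_betaPreimageWord_not_mem_preserving (s : Fin 3) :
    theta (evalWord betaPreimageWord) ∉ preserving s :=
  theta_evalWord_not_mem_preserving [true, true, false] [true, false, false] (by decide)
    (by decide) (by decide) (by revert s; decide)

/-! ### Elements of the preimage of the 3-colorable subgroup that have few fixed points. -/

theorem theta_evalWord_mem_threeColorable {U : List (ℕ × Bool)} (Tp Tm : BinaryTree Unit)
    (c : ℕ → ZMod 3) (hU : ∀ p ∈ U, p.1 < 2) (hU' : ∀ p ∈ alphaWord U, p.1 < 2)
    (hw : (leafWords Tp).map (wordAct (betaWord (alphaWord U))) = (leafWords Tm).map some)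
    (hc : ∀ e ∈ edgeRegions Tp 0 ++ edgeRegions Tm 0, c e.1 ≠ c e.2) :
    theta (evalWord U) ∈ threeColorable := by
  rw [theta_evalWord U hU hU']
  exact ⟨Tp, Tm, (represents_iff _ _ _).2 (forall₂_carries_of_map_wordAct hw), c, hc⟩

/-- The word `x₀x₁⁻¹x₀x₁x₀⁻¹x₁⁻¹` for an element that moves the points of `(0,3/4)`. -/
def leftMovingWord : List (ℕ × Bool) :=
  [(0, true), (1, false), (0, true), (1, true), (0, false), (1, false)]

/-- The word `x₀x₁x₀⁻¹x₁⁻¹x₀x₁x₀⁻¹` for an element that moves the points of `(1/4,1)`. -/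
def rightMovingWord : List (ℕ × Bool) :=
  [(0, true), (1, true), (0, false), (1, false), (0, true), (1, true), (0, false)]

theorem theta_leftMovingWord_mem_threeColorable :
    theta (evalWord leftMovingWord) ∈ threeColorable :=
  theta_evalWord_mem_threeColorable
    (caret (caret .nil (caret .nil (caret .nil .nil)))
      (caret (caret .nil .nil)
        (caret (caret .nil (caret .nil .nil)) (caret (caret .nil .nil) (caret .nil (caret .nil .nil))))))
    (caret
      (caret .nil
        (caret (caret (caret .nil (caret .nil .nil)) (caret .nil .nil)) (caret .nil (caret .nil .nil))))
      (caret (caret .nil .nil) (caret .nil (caret .nil .nil))))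
    -- Once the outer regions have colors `0` and `1`, each caret forces the color inside it. The 14
    -- leaves bound 15 regions, so the default value is never read.
    (fun j => [0, 1, 0, 1, 2, 1, 0, 1, 0, 2, 1, 0, 2, 0, 1].getD j 0)
    (by decide) (by decide) (by decide) (by decide)

theorem theta_rightMovingWord_mem_threeColorable :
    theta (evalWord rightMovingWord) ∈ threeColorable :=
  theta_evalWord_mem_threeColorable
    (caret (caret .nil (caret .nil (caret .nil .nil)))
      (caret
        (caret (caret .nil (caret .nil .nil)) (caret (caret .nil (caret .nil .nil)) (caret .nil .nil)))
        (caret .nil (caret .nil .nil))))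
    (caret
      (caret (caret (caret .nil (caret .nil (caret .nil .nil))) (caret .nil (caret .nil .nil)))
        (caret .nil (caret .nil .nil)))
      (caret (caret .nil .nil) (caret .nil (caret .nil .nil))))
    (fun j => [0, 1, 0, 1, 2, 0, 2, 1, 0, 1, 2, 1, 0, 2, 0, 1].getD j 0)
    (by decide) (by decide) (by decide) (by decide)

/-- On each relevant leaf interval the word acts affinely. The first interval meets its fixed-point
equation only at `0` and the one ending at `3/4` only there; those in between are disjoint from
their images. -/
theorem apply_leftMovingWord_ne (t : unitInterval) (h0 : 0 < (t : ℝ)) (h1 : (t : ℝ) < 3 / 4) :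
    (evalWord leftMovingWord).1 t ≠ t := by
  intro h
  obtain ⟨l, hl, s, rfl⟩ := exists_leaf_eq_cyl
    (caret (caret (caret .nil (caret .nil .nil)) .nil) (caret .nil .nil)) t
  have hl' : l ∈ [[false, false, false], [false, false, true, false], [false, false, true, true],
    [false, true], [true, false], [true, true]] := hl
  have hs0 := s.2.1
  have hs1 := s.2.2
  have key : ∀ v, wordAct leftMovingWord l = some v → (cyl v s : ℝ) = cyl l s := fun v hv => by
    rw [← carries_of_wordAct hv s, h]
  simp only [List.mem_cons, List.not_mem_nil, or_false] at hl'
  rcases hl' with rfl | rfl | rfl | rfl | rfl | rfl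
  · have e := key [false, false] (by decide)
    simp only [cyl, half_false_coe] at e h0 h1
    linarith
  · have e := key [false, true] (by decide)
    simp only [cyl, half_false_coe, half_true_coe] at e h0 h1
    linarith
  · have e := key [true, false, false] (by decide)
    simp only [cyl, half_false_coe, half_true_coe] at e h0 h1
    linarith
  · have e := key [true, false, true, false] (by decide)
    simp only [cyl, half_false_coe, half_true_coe] at e h0 h1
    linarith
  · have e := key [true, false, true, true] (by decide)
    simp only [cyl, half_false_coe, half_true_coe] at e h0 h1
    linarith
  · simp only [cyl, half_true_coe] at h1
    linarith

theorem apply_rightMovingWord_ne (t : unitInterval) (h0 : 1 / 4 < (t : ℝ)) (h1 : (t : ℝ) < 1) :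
    (evalWord rightMovingWord).1 t ≠ t := by
  intro h
  obtain ⟨l, hl, s, rfl⟩ := exists_leaf_eq_cyl
    (caret (caret .nil (caret (caret .nil .nil) .nil)) (caret .nil .nil)) t
  have hl' : l ∈ [[false, false], [false, true, false, false], [false, true, false, true],
    [false, true, true], [true, false], [true, true]] := hl
  have hs0 := s.2.1
  have hs1 := s.2.2
  have key : ∀ v, wordAct rightMovingWord l = some v → (cyl v s : ℝ) = cyl l s := fun v hv => by
    rw [← carries_of_wordAct hv s, h]
  simp only [List.mem_cons, List.not_mem_nil, or_false] at hl'
  rcases hl' with rfl | rfl | rfl | rfl | rfl | rfl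
  · simp only [cyl, half_false_coe] at h0
    linarith
  -- Here `[1/4, 5/16]` is stretched onto `[1/4, 1/2]`; the only fixed point is `1/4`, which `h0`
  -- excludes.
  · have e := key [false, true] (by decide)
    simp only [cyl, half_false_coe, half_true_coe] at e h0 h1
    linarith
  · have e := key [true, false] (by decide)
    simp only [cyl, half_false_coe, half_true_coe] at e h0 h1
    linarith
  · have e := key [true, true, false, false] (by decide)
    simp only [cyl, half_false_coe, half_true_coe] at e h0 h1
    linarith
  · have e := key [true, true, false, true] (by decide)
    simp only [cyl, half_false_coe, half_true_coe] at e h0 h1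
    linarith
  · have e := key [true, true, true] (by decide)
    simp only [cyl, half_true_coe] at e h0 h1
    linarith

/-! ### Comparison of the preimages with the listed subgroups. -/

theorem x_zero_mem_H : x 0 ∈ H := Subgroup.subset_closure (by simp)

theorem x_zero_mem_K₁ : x 0 ∈ K₁ := Subgroup.subset_closure (Or.inl x_zero_mem_H)

theorem x_zero_mem_K₂ : x 0 ∈ K₂ := Subgroup.subset_closure (Or.inl x_zero_mem_H)

theorem x_zero_mem_K₃ : x 0 ∈ K₃ := Subgroup.subset_closure (by simp)

theorem comap_theta_ne_stab {M : Subgroup ThompsonF} (hM : threeColorable ⊆ (M : Set ThompsonF))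
    {t : unitInterval} (h0 : 0 < t) (h1 : t < 1) : M.comap theta ≠ stab t := by
  intro h
  have key : ∀ f : ThompsonF, theta f ∈ threeColorable → f.1 t = t := fun f hf => by
    have : f ∈ M.comap theta := hM hf
    rw [h] at this
    exact this
  -- The ranges `(0, 3/4)` and `(1/4, 1)` of the two moving words cover `(0, 1)`; any cut in their
  -- overlap, or at `1/4`, would do.
  rcases le_or_gt (t : ℝ) (1 / 4) with ht | ht
  · exact apply_leftMovingWord_ne t h0 (by linarith)
      (key _ theta_leftMovingWord_mem_threeColorable)
  · exact apply_rightMovingWord_ne t ht h1 (key _ theta_rightMovingWord_mem_threeColorable)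

theorem comap_theta_ne_of_x_zero_mem {M K : Subgroup ThompsonF} {s : Fin 3}
    (hM : M ≤ preserving s) (hK : x 0 ∈ K) : M.comap theta ≠ K := by
  rintro rfl
  exact theta_x_zero_not_mem_preserving s (hM hK)

theorem comap_theta_ne_comap_beta_oriented {M : Subgroup ThompsonF} {s : Fin 3}
    (hM : M ≤ preserving s) : M.comap theta ≠ oriented.comap beta := by
  intro h
  have hm : evalWord betaPreimageWord ∈ M.comap theta := by
    rw [h]
    exact beta_betaPreimageWord_mem_oriented
  exact theta_betaPreimageWord_not_mem_preserving s (hM hm)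

end ThompsonF

theorem mainTheorem8 :
    ∀ M ∈ ({ThompsonF.M₀, ThompsonF.M₁, ThompsonF.M₂} : Set (Subgroup ThompsonF)),
      (∀ t : unitInterval, 0 < t → t < 1 →
        M.comap ThompsonF.theta ≠ ThompsonF.stab t) ∧
      M.comap ThompsonF.theta ≠ ThompsonF.oriented.comap ThompsonF.beta ∧
      M.comap ThompsonF.theta ≠ ThompsonF.K₁ ∧
      M.comap ThompsonF.theta ≠ ThompsonF.K₂ ∧
      M.comap ThompsonF.theta ≠ ThompsonF.K₃ := by
  intro M hM
  -- The argument uses only these two bounds on `M`: it contains `𝓕`, and it preserves the states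
  -- for some start state.
  obtain ⟨h3, s, hs⟩ : ThompsonF.threeColorable ⊆ (M : Set ThompsonF) ∧
      ∃ s, M ≤ ThompsonF.preserving s := by
    rcases hM with rfl | rfl | rfl
    · exact ⟨subset_union_left.trans Subgroup.subset_closure, _, ThompsonF.M₀_le_preserving⟩
    · exact ⟨subset_union_left.trans Subgroup.subset_closure, _, ThompsonF.M₁_le_preserving⟩
    · exact ⟨subset_union_left.trans Subgroup.subset_closure, _, ThompsonF.M₂_le_preserving⟩
  exact ⟨fun t h0 h1 => ThompsonF.comap_theta_ne_stab h3 h0 h1,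
    ThompsonF.comap_theta_ne_comap_beta_oriented hs,
    ThompsonF.comap_theta_ne_of_x_zero_mem hs ThompsonF.x_zero_mem_K₁,
    ThompsonF.comap_theta_ne_of_x_zero_mem hs ThompsonF.x_zero_mem_K₂,
    ThompsonF.comap_theta_ne_of_x_zero_mem hs ThompsonF.x_zero_mem_K₃⟩
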